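/- **Setting.** A server holds $N\ge 2$ files $W_1,\dots,W_N$, independent and uniformly distributed on $[2^F]$ ($F$ bits each), and serves $K\ge 1$ users over a shared error-free link; user $k$ has a cache. A placement and delivery scheme with normalized memory $M$ and rate $R$ consists of a conditional distribution $p_{\mathbf Z\mid\mathbf W}$ of the cache contents $\mathbf Z=(Z_1,\dots,Z_K)$, $Z_k\in[2^{MF}]$, given the files $\mathbf W$; for every demand vector $\mathbf d\in[N]^K$ a transmission $X_{\mathbf d}(\mathbf W,\mathbf Z)\in[2^{RF}]$; and for every $\mathbf d$ and every user $k$ an estimate $\widehat W_{d_k}$ of $W_{d_k}$ computed from $X_{\mathbf d}(\mathbf W,\mathbf Z)$ and $Z_k$ (the vector $\mathbf d$ being known to all). Here $[2^x]$ stands for $\{1,\dots,\lfloor 2^x\rfloor\}$. The scheme is $(\epsilon,\delta)$-private if $$\max_{\mathbf d\in[N]^K}\mathbb P\big((\widehat W_{d_1},\dots,\widehat W_{d_K})\ne(W_{d_1},\dots,W_{d_K})\big)\le\epsilon,\qquad \max_{\mathbf d\in[N]^K}\max_{k\in[K]} I\big(\mathbf W_{[N]\setminus\{d_k\}};\,X_{\mathbf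 d}(\mathbf W,\mathbf Z),Z_k\big)\le\delta .$$ The pair $(M,R)$ is privately achievable if for all $\epsilon,\delta>0$ there is an $(\epsilon,\delta)$-private scheme for every sufficiently large file size $F$, and $R^\star_P(M)=\inf\{R:(M,R)\text{ is privately achievable}\}$. The rate $R_C(M)$ of the centralized scheme is, for $M\le N(K-1)$, the value at $M$ of the lower convex envelope of the points $$\Big(M_t,\ \frac{K(N+M_t-1)}{N+(K+1)(M_t-1)}\Big),\quad M_t=\frac{Nt}{K-t}+1,\quad t\in\{0,1,\dots,K-2\},\qquad\text{and}\qquad (N(K-1),\,1),$$ and $R_C(M)=1$ for $M>N(K-1)$. **Theorem 3.** For every real $M\ge M_0:=1+\max\Big\{0,\ \dfrac{N(K-N)}{(N-1)K+N}\Big\}$, $$1\ \le\ \frac{R_C(M)}{R^\star_P(M)}\ \le\ 16 .$$ In particular, if $N\ge K$, these inequalities hold for every $M$ that is feasible, i.e. for which $(M,R)$ is privately achievable for some $R$. -/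

import Mathlib

noncomputable section

namespace PrivateCaching

/-! ### Information measures of finite-valued random variables -/

/-- The Shannon entropy `H(X)`, in bits, of a finite-valued random variable `X` on the discrete
probability space `(Ω, p)`. -/
def entropy {Ω α : Type} [Fintype α] (p : PMF Ω) (X : Ω → α) : ℝ :=
  (∑ a, Real.negMulLog ((p.map X) a).toReal) / Real.log 2

/-- The mutual information `I(X; Y) = H(X) + H(Y) - H(X, Y)`, in bits. -/
def mutualInfo {Ω α β : Type} [Fintype α] [Fintype β] (p : PMF Ω) (X : Ω → α) (Y : Ω → β) : ℝ :=
  entropy p X + entropy p Y - entropy p (fun ω => (X ω, Y ω))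

/-! ### The caching system -/

/-- The `N` files, each of `F` bits. -/
abbrev Files (N F : ℕ) : Type := Fin N → Fin (2 ^ F)

/-- The alphabet `[2 ^ (rF)]` of a content of `rF` bits; for a non-integral power it has
`⌊2 ^ (rF)⌋` symbols, the largest size that does not exceed `2 ^ (rF)`. -/
abbrev Alphabet (r : ℝ) (F : ℕ) : Type := Fin ⌊(2 : ℝ) ^ (r * (F : ℝ))⌋₊

/-- A placement and delivery scheme for `N` files of `F` bits and `K` users, with caches of `MF`
bits and transmissions of `RF` bits. -/
structure Scheme (N K F : ℕ) (M R : ℝ) where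
  /-- The conditional law of the cache contents `(Z_1, …, Z_K)` given the files. It does not depend
  on the demands. -/
  placement : Files N F → PMF (Fin K → Alphabet M F)
  /-- The server transmission `X_d(W, Z)` for the demand vector `d`. -/
  transmit : (Fin K → Fin N) → Files N F → (Fin K → Alphabet M F) → Alphabet R F
  /-- The estimate that user `k` makes of the requested file, from the (publicly known) demand
  vector, the transmission and the content of cache `k` only. -/
  decode : (Fin K → Fin N) → (k : Fin K) → Alphabet R F → Alphabet M F → Fin (2 ^ F)

namespace Scheme

variable {N K F : ℕ} {M R : ℝ}

/-- The joint law of files and cache contents: the files are independent and uniformly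
distributed, and the caches are filled according to `placement`. -/
def law (S : Scheme N K F M R) : PMF (Files N F × (Fin K → Alphabet M F)) :=
  (PMF.uniformOfFintype (Files N F)).bind fun W => (S.placement W).map fun Z => (W, Z)

/-- The worst-case probability of error `P_e`. -/
def errorProb (S : Scheme N K F M R) : ℝ :=
  ⨆ d : Fin K → Fin N,
    (S.law.toOuterMeasure
      {ω | (fun k => S.decode d k (S.transmit d ω.1 ω.2) (ω.2 k)) ≠ fun k => ω.1 (d k)}).toReal

/-- The information leakage `L`: the largest value, over all demand vectors `d` and all users `k`,
of `I(W_{[N] ∖ {d_k}}; X_d(W, Z), Z_k)`. -/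
def leakage (S : Scheme N K F M R) : ℝ :=
  ⨆ d : Fin K → Fin N, ⨆ k : Fin K,
    mutualInfo S.law
      (fun ω => fun i : {i : Fin N // i ≠ d k} => ω.1 i)
      (fun ω => (S.transmit d ω.1 ω.2, ω.2 k))

/-- `(ε, δ)`-private schemes. -/
def IsPrivate (S : Scheme N K F M R) (ε δ : ℝ) : Prop :=
  S.errorProb ≤ ε ∧ S.leakage ≤ δ

end Scheme

/-- The memory-rate pair `(M, R)` is privately achievable: for all `ε, δ > 0` and every large enough
file size `F` there is an `(ε, δ)`-private scheme. -/
def PrivatelyAchievable (N K : ℕ) (M R : ℝ) : Prop :=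
  ∀ ε > 0, ∀ δ > 0, ∃ F₀ : ℕ, ∀ F ≥ F₀, ∃ S : Scheme N K F M R, S.IsPrivate ε δ

/-- The optimal server transmission rate `R*_P(M)`. -/
def optimalRate (N K : ℕ) (M : ℝ) : ℝ :=
  sInf {R : ℝ | PrivatelyAchievable N K M R}

/-! ### The rate of the centralized scheme -/

/-- The memory `N t / (K - t) + 1` of the `t`-th corner point. -/
def cornerMemory (N K t : ℕ) : ℝ := (N : ℝ) * t / ((K : ℝ) - t) + 1

/-- The rate `K (N + M - 1) / (N + (K + 1) (M - 1))`, which the scheme has at the memories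
`M = cornerMemory N K t`. -/
def cornerRate (N K : ℕ) (M : ℝ) : ℝ :=
  (K : ℝ) * ((N : ℝ) + M - 1) / ((N : ℝ) + ((K : ℝ) + 1) * (M - 1))

/-- The memory-rate points of the scheme: those for `t ∈ {0, …, K - 2}`, and `(N (K - 1), 1)`. -/
def cornerPoints (N K : ℕ) : Set (ℝ × ℝ) :=
  {P | ∃ t : ℕ, t + 2 ≤ K ∧ P = (cornerMemory N K t, cornerRate N K (cornerMemory N K t))} ∪
    {((N : ℝ) * ((K : ℝ) - 1), 1)}

/-- The rate `R_C(M)` of the centralized scheme: the (lower) convex envelope of the corner points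
for memories up to `N (K - 1)`, and the rate `1` of the last corner point for larger memories
(the additional memory is left unused). -/
def centralizedRate (N K : ℕ) (M : ℝ) : ℝ :=
  if M ≤ (N : ℝ) * ((K : ℝ) - 1) then sInf {r : ℝ | (M, r) ∈ convexHull ℝ (cornerPoints N K)}
  else 1

/-- The memory threshold `M_0 = 1 + max {0, N (K - N) / ((N - 1) K + N)}`. -/
def thresholdMemory (N K : ℕ) : ℝ :=
  1 + max 0 ((N : ℝ) * ((K : ℝ) - N) / (((N : ℝ) - 1) * K + N))

end PrivateCaching

end

noncomputable section

namespace PrivateCaching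

open Finset

/-! ### Entropy inequalities -/

/-! The ratio is at least 1 because the centralized scheme can be realized, and at most 16 by a
converse that combines several users with several demands.

Converse (`PrivatelyAchievable.converse`). Let p + 1 demands ask, through the first l + 1 users, for
(l + 1)(p + 1) distinct files. The view of user 0 under one demand is almost independent of all
files but the one it requests, yet together with the p other transmissions and l other caches it
determines all these files. The added data must carry all but one of them: (l + 1)(p + 1) - 1 ≤ pR +
lM. The cases (0, 1) and (1, 0) of (l, p) give R ≥ 1, and M ≥ 1 if K ≥ 2.

Achievability. Every file is encoded into shares indexed by the t-subsets of the users, so that the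
shares of the subsets containing a given user reveal nothing (`powerSumSharing`, by Vandermonde
matrices). For each (t + 1)-subset B the server sends the sum over j in B of the share B \ {j} of
the file wanted by j, masked by a key cached at B. This has memory M_t and rate K/(t + 1). Additive
sharing with a single transmission gives the last corner, `convex_perfectlyAchievable` interpolates,
and `PerfectScheme.exists_scheme` passes to files of F bits with a small error and no leakage.

Gap. Beyond the last corner the rate is 1 and R ≥ 1 suffices. Otherwise (K ≥ 2) take the largest
corner M_t ≤ M with t ≤ K - 2; then R_C ≤ K/(t + 1), and again R ≥ 1 suffices if this is at most 16.
If not, M < M_s with s = t + 1, and the converse with about K/(8s) users and 8sN/K demands gives R ≥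
K/(16s) (`div_le_sixteen_mul`). This requires K < N(s + 1), which M ≥ M_0 ensures: for K > N, M_0 is
the corner formula at the real parameter t = K/N - 1. -/

/-- The entropy, in nats, of a probability mass function on a finite type. -/
def pmfEntropy {α : Type} [Fintype α] (q : PMF α) : ℝ := ∑ a, Real.negMulLog (q a).toReal

theorem entropy_eq {Ω α : Type} [Fintype α] (p : PMF Ω) (X : Ω → α) :
    entropy p X = pmfEntropy (p.map X) / Real.log 2 := rfl

theorem sum_toReal {α : Type} [Fintype α] (q : PMF α) : ∑ a, (q a).toReal = 1 := by
  have h := q.tsum_coe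
  rw [tsum_fintype] at h
  rw [← ENNReal.toReal_sum (fun a _ => q.apply_ne_top a), h, ENNReal.toReal_one]

open Classical in
theorem map_toReal {α β : Type} [Fintype α] (q : PMF α) (f : α → β) (b : β) :
    ((q.map f) b).toReal = ∑ a, if f a = b then (q a).toReal else 0 := by
  rw [PMF.map_apply, tsum_fintype, ENNReal.toReal_sum]
  · refine Finset.sum_congr rfl fun a _ => ?_
    by_cases h : f a = b
    · simp [h]
    · simp [h, Ne.symm h]
  · intro a _
    split_ifs
    · exact q.apply_ne_top a
    · simp

/-- Gibbs' inequality. -/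
theorem pmfEntropy_le_cross {α : Type} [Fintype α] (q : PMF α) (r : α → ℝ) (h0 : ∀ a, 0 ≤ r a)
    (hr : ∀ a, r a = 0 → (q a).toReal = 0) (hs : ∑ a, r a ≤ 1) :
    pmfEntropy q ≤ -∑ a, (q a).toReal * Real.log (r a) := by
  have key : ∀ a, Real.negMulLog (q a).toReal ≤
      -((q a).toReal * Real.log (r a)) + (r a - (q a).toReal) := by
    intro a
    rcases (h0 a).eq_or_lt with h | h
    · simp [hr a h.symm, ← h]
    · rcases (ENNReal.toReal_nonneg (a := q a)).eq_or_lt with hq | hq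
      · simp [← hq, h.le]
      · have h1 := Real.log_le_sub_one_of_pos (div_pos h hq)
        rw [Real.log_div h.ne' hq.ne'] at h1
        have h2 := mul_le_mul_of_nonneg_left h1 hq.le
        have h3 : (q a).toReal * (r a / (q a).toReal - 1) = r a - (q a).toReal := by
          field_simp
        rw [h3] at h2
        unfold Real.negMulLog
        linarith
  calc pmfEntropy q ≤ ∑ a, (-((q a).toReal * Real.log (r a)) + (r a - (q a).toReal)) :=
        Finset.sum_le_sum fun a _ => key a
    _ = -∑ a, (q a).toReal * Real.log (r a) + (∑ a, r a - 1) := by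
        rw [Finset.sum_add_distrib, Finset.sum_sub_distrib, sum_toReal, Finset.sum_neg_distrib]
    _ ≤ _ := by linarith

theorem pmfEntropy_le_log_card {α : Type} [Fintype α] [Nonempty α] (q : PMF α) :
    pmfEntropy q ≤ Real.log (Fintype.card α) := by
  have hc : (0 : ℝ) < Fintype.card α := by exact_mod_cast Fintype.card_pos
  refine (pmfEntropy_le_cross q (fun _ => (Fintype.card α : ℝ)⁻¹) (fun _ => by positivity)
    (fun a h => absurd h (by positivity)) ?_).trans ?_
  · simp [hc.ne']
  · rw [← Finset.sum_mul, sum_toReal]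
    simp

theorem pmfEntropy_uniform {α : Type} [Fintype α] [Nonempty α] :
    pmfEntropy (PMF.uniformOfFintype α) = Real.log (Fintype.card α) := by
  have hc : (0 : ℝ) < Fintype.card α := by exact_mod_cast Fintype.card_pos
  simp [pmfEntropy, Real.negMulLog, hc.ne']

theorem toReal_le_map {α β : Type} [Fintype α] (q : PMF α) (f : α → β) (a : α) :
    (q a).toReal ≤ ((q.map f) (f a)).toReal := by
  classical
  rw [map_toReal]
  have := Finset.single_le_sum (f := fun a' => if f a' = f a then (q a').toReal else 0)
    (fun i _ => by split_ifs <;> simp) (Finset.mem_univ a)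
  simpa using this

-- A point has at most the mass of its fibre, so replacing the former by the latter inside the
-- logarithm only lowers the entropy.
open Classical in
theorem pmfEntropy_map_le {α β : Type} [Fintype α] [Fintype β] (q : PMF α) (f : α → β) :
    pmfEntropy (q.map f) ≤ pmfEntropy q := by
  have h1 : ∀ b, Real.negMulLog ((q.map f) b).toReal =
      ∑ a, if f a = b then -((q a).toReal * Real.log ((q.map f) (f a)).toReal) else 0 := by
    intro b
    rw [Real.negMulLog, neg_mul, ← mul_neg]
    nth_rewrite 1 [map_toReal]
    rw [Finset.sum_mul]
    refine Finset.sum_congr rfl fun a _ => ?_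
    split_ifs with h
    · rw [h]; ring
    · simp
  unfold pmfEntropy
  simp_rw [h1]
  rw [Finset.sum_comm]
  refine Finset.sum_le_sum fun a _ => ?_
  rw [Finset.sum_ite_eq]
  simp only [Finset.mem_univ, if_true]
  rcases (ENNReal.toReal_nonneg (a := q a)).eq_or_lt with hq | hq
  · simp [← hq]
  · have h3 := mul_le_mul_of_nonneg_left (Real.log_le_log hq (toReal_le_map q f a)) hq.le
    rw [Real.negMulLog]
    linarith

open Classical in
theorem sum_mul_comp {α β : Type} [Fintype α] [Fintype β] (q : PMF α) (f : α → β) (g : β → ℝ) :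
    ∑ a, (q a).toReal * g (f a) = ∑ b, ((q.map f) b).toReal * g b := by
  simp_rw [map_toReal, Finset.sum_mul, ite_mul, zero_mul]
  rw [Finset.sum_comm]
  refine Finset.sum_congr rfl fun a _ => ?_
  rw [Finset.sum_ite_eq]
  simp

/-- Gibbs' inequality against the product of the two marginals. -/
theorem pmfEntropy_prod_le {α β : Type} [Fintype α] [Fintype β] (q : PMF (α × β)) :
    pmfEntropy q ≤ pmfEntropy (q.map Prod.fst) + pmfEntropy (q.map Prod.snd) := by
  set u := fun a => ((q.map Prod.fst) a).toReal with hu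
  set v := fun b => ((q.map Prod.snd) b).toReal with hv
  have hz : ∀ x : α × β, u x.1 * v x.2 = 0 → (q x).toReal = 0 := by
    intro x hx
    have h1 : (q x).toReal ≤ u x.1 := toReal_le_map q Prod.fst x
    have h2 : (q x).toReal ≤ v x.2 := toReal_le_map q Prod.snd x
    have h3 : (0 : ℝ) ≤ (q x).toReal := ENNReal.toReal_nonneg
    rcases mul_eq_zero.mp hx with h | h <;> linarith
  refine (pmfEntropy_le_cross q (fun x => u x.1 * v x.2)
    (fun x => mul_nonneg ENNReal.toReal_nonneg ENNReal.toReal_nonneg) hz ?_).trans ?_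
  · rw [Fintype.sum_prod_type]
    simp_rw [← Finset.mul_sum]
    rw [← Finset.sum_mul, sum_toReal, sum_toReal, one_mul]
  · have h1 : ∀ x : α × β, (q x).toReal * Real.log (u x.1 * v x.2) =
        (q x).toReal * Real.log (u x.1) + (q x).toReal * Real.log (v x.2) := by
      intro x
      by_cases hx : u x.1 * v x.2 = 0
      · simp [hz x hx]
      · rw [Real.log_mul (left_ne_zero_of_mul hx) (right_ne_zero_of_mul hx), mul_add]
    rw [Finset.sum_congr rfl fun x _ => h1 x, Finset.sum_add_distrib,
      sum_mul_comp q Prod.fst (fun a => Real.log (u a)),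
      sum_mul_comp q Prod.snd (fun b => Real.log (v b))]
    unfold pmfEntropy Real.negMulLog
    simp only [neg_mul, Finset.sum_neg_distrib, hu, hv]
    linarith

section

variable {Ω α β γ : Type} [Fintype α] [Fintype β] (p : PMF Ω)

theorem log_two_pos : (0 : ℝ) < Real.log 2 := Real.log_pos one_lt_two

theorem entropy_comp_le (X : Ω → α) (f : α → β) : entropy p (fun ω => f (X ω)) ≤ entropy p X := by
  rw [entropy_eq, entropy_eq]
  have h : p.map (fun ω => f (X ω)) = (p.map X).map f := (PMF.map_comp X p f).symm
  rw [h]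
  exact div_le_div_of_nonneg_right (pmfEntropy_map_le _ _) log_two_pos.le

theorem entropy_pair_le (X : Ω → α) (Y : Ω → β) :
    entropy p (fun ω => (X ω, Y ω)) ≤ entropy p X + entropy p Y := by
  rw [entropy_eq, entropy_eq, entropy_eq, ← add_div]
  have h := pmfEntropy_prod_le (p.map fun ω => (X ω, Y ω))
  rw [PMF.map_comp, PMF.map_comp] at h
  exact div_le_div_of_nonneg_right h log_two_pos.le

theorem entropy_le_logb_card (X : Ω → α) : entropy p X ≤ Real.logb 2 (Fintype.card α) := by
  have : Nonempty α := (p.map X).support_nonempty.to_type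
  exact div_le_div_of_nonneg_right (pmfEntropy_le_log_card _) log_two_pos.le

theorem entropy_of_uniform [Nonempty α] (X : Ω → α) (h : p.map X = PMF.uniformOfFintype α) :
    entropy p X = Real.logb 2 (Fintype.card α) := by
  rw [entropy_eq, h, pmfEntropy_uniform, Real.logb]

/-- The entropy of a random variable that equals `none` with probability at least `1 - η`. -/
theorem entropy_option_le (E : Ω → Option α) (η : ℝ) [Nonempty α]
    (h : 1 - η ≤ ((p.map E) none).toReal) :
    entropy p E ≤ 1 + η * Real.logb 2 (Fintype.card α) := by
  have hc : (1 : ℝ) ≤ Fintype.card α := by exact_mod_cast Fintype.card_pos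
  -- The reference law puts mass 1/2 on `none` and spreads the other 1/2 evenly: one bit in any
  -- case, plus log |α| with probability at most η.
  have hg := pmfEntropy_le_cross (p.map E)
    (fun o => o.elim (1 / 2) fun _ => 1 / (2 * (Fintype.card α : ℝ)))
    (by rintro (_ | a) <;> simp) (by rintro (_ | a) h <;> simp at h)
    (by
      rw [Fintype.sum_option]
      simp only [Option.elim, Finset.sum_const, Finset.card_univ, nsmul_eq_mul]
      field_simp
      norm_num)
  have hs := sum_toReal (p.map E)
  rw [Fintype.sum_option] at hs hg
  simp only [Option.elim] at hg
  rw [← Finset.sum_mul] at hg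
  have h1 : Real.log (1 / 2) = -Real.log 2 := by rw [one_div, Real.log_inv]
  have h2 : Real.log (1 / (2 * (Fintype.card α : ℝ))) =
      -(Real.log 2 + Real.log (Fintype.card α)) := by
    rw [one_div, Real.log_inv, Real.log_mul two_ne_zero (by positivity)]
  rw [h1, h2] at hg
  rw [entropy_eq, div_le_iff₀ log_two_pos, Real.logb]
  have h3 : (1 + η * (Real.log (Fintype.card α) / Real.log 2)) * Real.log 2 =
      Real.log 2 + η * Real.log (Fintype.card α) := by
    have := log_two_pos.ne'
    field_simp
  rw [h3]
  have h4 : 0 ≤ Real.log (Fintype.card α : ℝ) := Real.log_nonneg hc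
  set A := ((p.map E) none).toReal
  set B := ∑ i, ((p.map E) (some i)).toReal
  have h5 : B ≤ η := by linarith
  have h6 := mul_le_mul_of_nonneg_right h5 h4
  have h7 : A = 1 - B := by linarith
  rw [h7] at hg
  nlinarith

end

/-! ### The converse bound -/

theorem logb_card_files (F : ℕ) (ι : Type) [Fintype ι] [DecidableEq ι] :
    Real.logb 2 (Fintype.card (ι → Fin (2 ^ F))) = Fintype.card ι * F := by
  rw [Fintype.card_fun, Fintype.card_fin, ← pow_mul, Nat.cast_pow, Nat.cast_ofNat,
    Real.logb_pow, Real.logb_self_eq_one one_lt_two]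
  push_cast
  ring

theorem toOuterMeasure_ne_top {Ω : Type} (p : PMF Ω) (s : Set Ω) : p.toOuterMeasure s ≠ ⊤ := by
  refine ne_top_of_le_ne_top ENNReal.one_ne_top ?_
  rw [← (p.toOuterMeasure_apply_eq_one_iff Set.univ).mpr (Set.subset_univ _)]
  exact p.toOuterMeasure.mono (Set.subset_univ _)

theorem toReal_toOuterMeasure_mono {Ω : Type} (p : PMF Ω) {s t : Set Ω} (h : s ⊆ t) :
    (p.toOuterMeasure s).toReal ≤ (p.toOuterMeasure t).toReal :=
  ENNReal.toReal_mono (toOuterMeasure_ne_top p t) (p.toOuterMeasure.mono h)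

theorem one_sub_le_of_compl {Ω : Type} (p : PMF Ω) (s : Set Ω) (η : ℝ)
    (h : (p.toOuterMeasure s).toReal ≤ η) : 1 - η ≤ (p.toOuterMeasure sᶜ).toReal := by
  have hne := toOuterMeasure_ne_top p
  have h1 : (1 : ENNReal) ≤ p.toOuterMeasure s + p.toOuterMeasure sᶜ := by
    rw [← (p.toOuterMeasure_apply_eq_one_iff Set.univ).mpr (Set.subset_univ _),
      ← Set.union_compl_self s]
    exact MeasureTheory.measure_union_le s sᶜ
  have h2 := ENNReal.toReal_mono (ENNReal.add_ne_top.mpr ⟨hne s, hne sᶜ⟩) h1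
  rw [ENNReal.toReal_add (hne _) (hne _), ENNReal.toReal_one] at h2
  linarith

/-- If `Y` hardly depends on the files other than `i₀`, while `Y` and `T` together determine the
files in `D` up to an error probability `η`, then `T` carries about `(|D| - 1) F` bits. -/
theorem card_sub_one_mul_le {Ω α β : Type} [Fintype α] [Fintype β] {N F : ℕ} (p : PMF Ω)
    (W : Ω → Files N F) (hW : p.map W = PMF.uniformOfFintype (Files N F)) (i₀ : Fin N)
    (D : Finset (Fin N)) (Y : Ω → α) (T : Ω → β) (g : α → β → Files N F) (δ η : ℝ)
    (hleak : mutualInfo p (fun ω => fun i : {i : Fin N // i ≠ i₀} => W ω i) Y ≤ δ)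
    (herr : (p.toOuterMeasure {ω | ∃ i ∈ D, g (Y ω) (T ω) i ≠ W ω i}).toReal ≤ η) :
    ((D.card : ℝ) - 1) * F ≤ δ + Real.logb 2 (Fintype.card β) + 1 + η * (N * F) := by
  classical
  set V : Ω → {i : Fin N // i ≠ i₀} → Fin (2 ^ F) := fun ω i => W ω i with hV
  set O : Ω → {i : Fin N // i ∉ D} → Fin (2 ^ F) := fun ω i => W ω i with hO
  -- An erratum in place of Fano's inequality: it repeats all the files when decoding fails and is
  -- `none` otherwise, so its entropy is small.
  set E : Ω → Option (Files N F) := fun ω =>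
    if ∃ i ∈ D, g (Y ω) (T ω) i ≠ W ω i then some (W ω) else none with hE
  have hHW : entropy p W = N * F := by
    rw [entropy_of_uniform p W hW, logb_card_files, Fintype.card_fin]
  have hHV : (N : ℝ) * F ≤ entropy p V + F := by
    have h1 := entropy_comp_le p (fun ω => (V ω, W ω i₀))
      (fun x i => if h : i ≠ i₀ then x.1 ⟨i, h⟩ else x.2)
    have h2 : (fun ω => (fun x : ({i : Fin N // i ≠ i₀} → Fin (2 ^ F)) × Fin (2 ^ F) =>
        fun i => if h : i ≠ i₀ then x.1 ⟨i, h⟩ else x.2) (V ω, W ω i₀)) = W := by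
      funext ω i
      by_cases h : i = i₀
      · subst h; simp
      · simp [h, hV]
    have h3 : entropy p W ≤ entropy p (fun ω => (V ω, W ω i₀)) := by
      rw [← h2]; simpa using h1
    have h4 := entropy_pair_le p V (fun ω => W ω i₀)
    have h5 := entropy_le_logb_card p (fun ω => W ω i₀)
    rw [Fintype.card_fin, Nat.cast_pow, Nat.cast_ofNat, Real.logb_pow,
      Real.logb_self_eq_one one_lt_two, mul_one] at h5
    linarith
  have hHE : entropy p E ≤ 1 + η * (N * F) := by
    have h1 := entropy_option_le p E η ?_
    · rwa [logb_card_files, Fintype.card_fin] at h1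
    · rw [← PMF.toOuterMeasure_apply_singleton, PMF.toOuterMeasure_map_apply]
      convert one_sub_le_of_compl p _ η herr using 3
      ext ω
      simp only [hE, Set.mem_preimage, Set.mem_singleton_iff, Set.mem_compl_iff, Set.mem_ofPred_eq]
      split_ifs with h <;> simp [h]
  have hHO : entropy p O ≤ ((N : ℝ) - D.card) * F := by
    have h1 := entropy_le_logb_card p O
    rw [logb_card_files] at h1
    have h2 : Fintype.card {i : Fin N // i ∉ D} = N - D.card := by
      rw [Fintype.card_subtype_compl]; simp
    have h3 : D.card ≤ N := by simpa using Finset.card_le_univ D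
    rwa [h2, Nat.cast_sub h3] at h1
  have hVY : entropy p (fun ω => (V ω, Y ω)) ≤
      entropy p (fun ω => ((Y ω, T ω), (E ω, O ω))) := by
    have h1 := entropy_comp_le p (fun ω => ((Y ω, T ω), (E ω, O ω)))
      (fun x => ((fun i : {i : Fin N // i ≠ i₀} => (x.2.1.elim
        (fun i : Fin N => if h : i ∈ D then g x.1.1 x.1.2 i else x.2.2 ⟨i, h⟩) id : Files N F) i.1),
        x.1.1))
    refine le_of_eq_of_le (congrArg _ ?_) h1
    funext ω
    refine Prod.ext ?_ rfl
    funext i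
    simp only [hE, hV, hO]
    split_ifs with hex
    · simp
    · push Not at hex
      simp only [Option.elim]
      split_ifs with hi
      · exact (hex _ hi).symm
      · rfl
  -- H(V, Y) ≤ H(Y) + H(T) + H(E) + H(O), and H(Y) cancels in the mutual information; no conditional
  -- entropies are needed.
  have h1 := entropy_pair_le p (fun ω => (Y ω, T ω)) (fun ω => (E ω, O ω))
  have h2 := entropy_pair_le p Y T
  have h3 := entropy_pair_le p E O
  have h4 := entropy_le_logb_card p T
  unfold mutualInfo at hleak
  linarith

namespace Scheme

variable {N K F : ℕ} {M R : ℝ}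

theorem law_map_fst (S : Scheme N K F M R) :
    S.law.map Prod.fst = PMF.uniformOfFintype (Files N F) := by
  unfold law
  rw [PMF.map_bind]
  simp_rw [PMF.map_comp]
  have : ∀ W : Files N F, (S.placement W).map (Prod.fst ∘ fun Z => (W, Z)) = PMF.pure W := fun W =>
    PMF.map_const _ _
  simp_rw [this]
  exact PMF.bind_pure _

theorem error_le (S : Scheme N K F M R) (d : Fin K → Fin N) :
    (S.law.toOuterMeasure
      {ω | (fun k => S.decode d k (S.transmit d ω.1 ω.2) (ω.2 k)) ≠ fun k => ω.1 (d k)}).toReal ≤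
      S.errorProb :=
  le_ciSup (f := fun d : Fin K → Fin N => (S.law.toOuterMeasure
      {ω | (fun k => S.decode d k (S.transmit d ω.1 ω.2) (ω.2 k)) ≠ fun k => ω.1 (d k)}).toReal)
    (Set.finite_range _).bddAbove d

theorem mutualInfo_le (S : Scheme N K F M R) (d : Fin K → Fin N) (k : Fin K) :
    mutualInfo S.law
      (fun ω => fun i : {i : Fin N // i ≠ d k} => ω.1 i)
      (fun ω => (S.transmit d ω.1 ω.2, ω.2 k)) ≤ S.leakage := by
  refine le_trans ?_ (le_ciSup (Set.finite_range _).bddAbove d)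
  exact le_ciSup (f := fun k => mutualInfo S.law
      (fun ω => fun i : {i : Fin N // i ≠ d k} => ω.1 i)
      (fun ω => (S.transmit d ω.1 ω.2, ω.2 k))) (Set.finite_range _).bddAbove k

end Scheme

theorem toReal_biUnion_le {Ω ι : Type} [Fintype ι] (p : PMF Ω) (s : ι → Set Ω) (ε : ℝ)
    (h : ∀ i, (p.toOuterMeasure (s i)).toReal ≤ ε) :
    (p.toOuterMeasure (⋃ i, s i)).toReal ≤ Fintype.card ι * ε := by
  have hne := toOuterMeasure_ne_top p
  calc (p.toOuterMeasure (⋃ i, s i)).toReal ≤ (∑ i, p.toOuterMeasure (s i)).toReal := by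
        refine ENNReal.toReal_mono (ENNReal.sum_ne_top.mpr fun i _ => hne _) ?_
        exact MeasureTheory.measure_iUnion_fintype_le _ _
    _ = ∑ i, (p.toOuterMeasure (s i)).toReal := ENNReal.toReal_sum fun i _ => hne _
    _ ≤ ∑ _i : ι, ε := Finset.sum_le_sum fun i _ => h i
    _ = _ := by simp

theorem logb_card_alphabet_le (r : ℝ) (F : ℕ) (h : Nonempty (Alphabet r F)) :
    Real.logb 2 (Fintype.card (Alphabet r F)) ≤ r * F := by
  have h1 : 0 < Fintype.card (Alphabet r F) := Fintype.card_pos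
  rw [Real.logb_le_iff_le_rpow one_lt_two (by exact_mod_cast h1), Fintype.card_fin]
  exact Nat.floor_le (by positivity)

/-- The view Y of user 0 under demand 0 is completed by T, the p further transmissions and l further
caches; the union bound over the p + 1 demands gives the error (p + 1)ε. -/
theorem Scheme.converse {N K F : ℕ} {M R : ℝ} (S : Scheme N K F M R) {ε δ : ℝ}
    (hS : S.IsPrivate ε δ) (l p : ℕ) (hl : l + 1 ≤ K) (hp : (l + 1) * (p + 1) ≤ N) :
    ((((l + 1) * (p + 1) : ℕ) : ℝ) - 1) * F ≤
      δ + (p * (R * F) + l * (M * F)) + 1 + ((p + 1) * ε) * (N * F) := by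
  classical
  have hN : 0 < N := lt_of_lt_of_le (by positivity) hp
  have hK : 0 < K := by omega
  have hidx : ∀ (i : Fin (p + 1)) (k : ℕ), k < l + 1 → i * (l + 1) + k < N := by
    intro i k hk
    have h1 : (i : ℕ) ≤ p := by omega
    have h2 := Nat.mul_le_mul_right (l + 1) h1
    have h3 : (l + 1) * (p + 1) = p * (l + 1) + (l + 1) := by ring
    omega
  -- user `k` asks for file `i (l + 1) + k` in the `i`-th demand
  set dem : Fin (p + 1) → Fin K → Fin N := fun i k =>
    if h : (k : ℕ) < l + 1 then ⟨i * (l + 1) + k, hidx i k h⟩ else ⟨0, hN⟩ with hdem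
  set k₀ : Fin K := ⟨0, hK⟩ with hk₀
  set D : Finset (Fin N) := Finset.univ.filter fun n => (n : ℕ) < (l + 1) * (p + 1) with hD
  have hDc : D.card = (l + 1) * (p + 1) := by
    rw [hD, Fin.card_filter_val_lt, min_eq_right hp]
  set Y : Files N F × (Fin K → Alphabet M F) → Alphabet R F × Alphabet M F := fun ω =>
    (S.transmit (dem 0) ω.1 ω.2, ω.2 k₀)
  set T : Files N F × (Fin K → Alphabet M F) →
      (Fin p → Alphabet R F) × (Fin l → Alphabet M F) := fun ω =>
    (fun i => S.transmit (dem i.succ) ω.1 ω.2, fun j => ω.2 ⟨j + 1, by omega⟩)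
  have hmod : ∀ n : ℕ, n % (l + 1) < l + 1 := fun n => Nat.mod_lt _ (by omega)
  set g : Alphabet R F × Alphabet M F → (Fin p → Alphabet R F) × (Fin l → Alphabet M F) →
      Files N F := fun y t n =>
    -- File n is the one that user n mod (l + 1) requests in demand number n / (l + 1).
    if hn : (n : ℕ) / (l + 1) < p + 1 then
      S.decode (dem ⟨n / (l + 1), hn⟩) ⟨n % (l + 1), (hmod n).trans_le hl⟩
        ((Fin.cons y.1 t.1 : Fin (p + 1) → Alphabet R F) ⟨n / (l + 1), hn⟩)
        ((Fin.cons y.2 t.2 : Fin (l + 1) → Alphabet M F) ⟨n % (l + 1), hmod n⟩)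
    else ⟨0, by positivity⟩ with hg
  have hX : ∀ ω i, (Fin.cons (Y ω).1 (T ω).1 : Fin (p + 1) → Alphabet R F) i =
      S.transmit (dem i) ω.1 ω.2 := by
    intro ω i
    refine Fin.cases ?_ (fun i => ?_) i <;> rfl
  have hZ : ∀ ω (j : Fin (l + 1)), (Fin.cons (Y ω).2 (T ω).2 : Fin (l + 1) → Alphabet M F) j =
      ω.2 ⟨j, j.2.trans_le hl⟩ := by
    intro ω j
    refine Fin.cases ?_ (fun j => ?_) j <;> rfl
  have herr : (S.law.toOuterMeasure {ω | ∃ i ∈ D, g (Y ω) (T ω) i ≠ ω.1 i}).toReal ≤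
      (p + 1) * ε := by
    have h1 := toReal_biUnion_le S.law (fun i : Fin (p + 1) =>
      {ω | (fun k => S.decode (dem i) k (S.transmit (dem i) ω.1 ω.2) (ω.2 k)) ≠
        fun k => ω.1 (dem i k)}) ε (fun i => (S.error_le (dem i)).trans hS.1)
    rw [Fintype.card_fin] at h1
    push_cast at h1
    refine le_trans (toReal_toOuterMeasure_mono _ ?_) h1
    · rintro ω ⟨n, hn, hne⟩
      have hn' : (n : ℕ) / (l + 1) < p + 1 := by
        rw [Nat.div_lt_iff_lt_mul (by omega)]
        have : (n : ℕ) < (l + 1) * (p + 1) := by simpa [hD] using hn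
        rwa [mul_comm] at this
      refine Set.mem_iUnion.mpr ⟨⟨n / (l + 1), hn'⟩, fun heq => hne ?_⟩
      have h2 := congrFun heq ⟨n % (l + 1), (hmod n).trans_le hl⟩
      simp only [hg, hn', dif_pos, hX, hZ]
      refine h2.trans (congrArg ω.1 ?_)
      simp only [hdem, hmod, dif_pos]
      exact Fin.ext (Nat.div_add_mod' _ _)
  have hleak := (S.mutualInfo_le (dem 0) k₀).trans hS.2
  have key := card_sub_one_mul_le S.law Prod.fst S.law_map_fst (dem 0 k₀) D Y T g δ
    ((p + 1) * ε) hleak herr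
  rw [hDc] at key
  obtain ⟨ω, -⟩ := S.law.support_nonempty
  -- Needed because r may be negative: an empty alphabet has `logb` equal to 0, which would exceed
  -- rF.
  have hneM : Nonempty (Alphabet M F) := ⟨ω.2 k₀⟩
  have hneR : Nonempty (Alphabet R F) := ⟨S.transmit (dem 0) ω.1 ω.2⟩
  have hcard : Real.logb 2 (Fintype.card ((Fin p → Alphabet R F) × (Fin l → Alphabet M F))) ≤
      p * (R * F) + l * (M * F) := by
    rw [Fintype.card_prod, Fintype.card_fun, Fintype.card_fun, Fintype.card_fin p,
      Fintype.card_fin l]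
    have hr : (Fintype.card (Alphabet R F) : ℝ) ≠ 0 := by exact_mod_cast Fintype.card_ne_zero
    have hm : (Fintype.card (Alphabet M F) : ℝ) ≠ 0 := by exact_mod_cast Fintype.card_ne_zero
    rw [Nat.cast_mul, Nat.cast_pow, Nat.cast_pow, Real.logb_mul (by positivity) (by positivity),
      Real.logb_pow, Real.logb_pow]
    have h1 := logb_card_alphabet_le R F hneR
    have h2 := logb_card_alphabet_le M F hneM
    gcongr
  linarith

/-- The converse bound on the memory-rate tradeoff, from `l + 1` users and `p + 1` demands. -/
theorem PrivatelyAchievable.converse {N K : ℕ} {M R : ℝ} (h : PrivatelyAchievable N K M R)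
    (l p : ℕ) (hl : l + 1 ≤ K) (hp : (l + 1) * (p + 1) ≤ N) :
    ((l : ℝ) + 1) * (p + 1) - 1 ≤ p * R + l * M := by
  have hN : (0 : ℝ) < N := by exact_mod_cast lt_of_lt_of_le (by positivity) hp
  refine le_of_forall_pos_le_add fun η hη => ?_
  -- With this ε the error term is ηF/2; the constant δ + 1 = 2 is at most the other ηF/2 once F ≥
  -- 4/η.
  obtain ⟨F₀, hF⟩ := h (η / (2 * ((p + 1) * N))) (by positivity) 1 one_pos
  obtain ⟨F₁, hF₁⟩ := exists_nat_ge (4 / η)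
  obtain ⟨S, hS⟩ := hF (F₀ + F₁ + 1) (by omega)
  have key := S.converse hS l p hl hp
  set F := F₀ + F₁ + 1 with hFdef
  have hFpos : (0 : ℝ) < F := by positivity
  have h4 : 4 ≤ η * F := by
    have h5 : (F₁ : ℝ) ≤ F := by exact_mod_cast (by omega : F₁ ≤ F)
    have h6 := hF₁.trans h5
    rw [div_le_iff₀ hη] at h6
    linarith
  have h7 : (p + 1 : ℝ) * (η / (2 * ((p + 1) * N))) * (N * F) = η * F / 2 := by
    field_simp
  rw [h7] at key
  push_cast at key
  refine le_of_mul_le_mul_right ?_ hFpos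
  nlinarith

/-- For negative M the cache alphabet is empty, whereas the support of the law contains some cache
content. -/
theorem PrivatelyAchievable.nonneg_memory {N K : ℕ} {M R : ℝ} (h : PrivatelyAchievable N K M R)
    (hK : 1 ≤ K) : 0 ≤ M := by
  by_contra! hM
  obtain ⟨F₀, hF⟩ := h 1 one_pos 1 one_pos
  obtain ⟨S, -⟩ := hF (F₀ + 1) (by omega)
  obtain ⟨ω, -⟩ := S.law.support_nonempty
  have h0 : ⌊(2 : ℝ) ^ (M * ((F₀ + 1 : ℕ) : ℝ))⌋₊ = 0 := by
    rw [Nat.floor_eq_zero]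
    refine Real.rpow_lt_one_of_one_lt_of_neg one_lt_two ?_
    exact mul_neg_of_neg_of_pos hM (by positivity)
  have := (ω.2 ⟨0, hK⟩).2
  omega

/-! ### Perfect schemes -/

/-- A caching scheme with file alphabet `𝓦`, randomness uniform on `Ω`, transmission alphabet `𝓧`
and cache alphabets `𝓩 k`, in which every user decodes without error and learns nothing about the
files that it did not ask for. -/
structure PerfectScheme (N K : ℕ) (𝓦 Ω 𝓧 : Type) (𝓩 : Fin K → Type) where
  /-- The contents of the caches. -/
  cache : (Fin N → 𝓦) → Ω → ∀ k, 𝓩 k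
  /-- The transmission. -/
  tx : (Fin K → Fin N) → (Fin N → 𝓦) → Ω → 𝓧
  /-- The transmission is a function of the files and the caches. -/
  tx_eq : ∀ d W ω ω', cache W ω = cache W ω' → tx d W ω = tx d W ω'
  /-- The transmission and the cache determine the requested file. -/
  decodable : ∀ d k W W' ω ω', tx d W ω = tx d W' ω' → cache W ω k = cache W' ω' k →
    W (d k) = W' (d k)
  /-- The law of the view of a user depends on the requested file only. -/
  secret : ∀ d k W W', W (d k) = W' (d k) →
    ∃ σ : Ω ≃ Ω, ∀ ω, tx d W' (σ ω) = tx d W ω ∧ cache W' (σ ω) k = cache W ω k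

/-! ### Uniform distributions -/

theorem uniform_prod {α β : Type} [Fintype α] [Fintype β] [Nonempty α] [Nonempty β] :
    PMF.uniformOfFintype (α × β) =
      (PMF.uniformOfFintype α).bind fun a => (PMF.uniformOfFintype β).map fun b => (a, b) := by
  classical
  ext ⟨a, b⟩
  rw [PMF.bind_apply, tsum_fintype, Finset.sum_eq_single a, PMF.map_apply, tsum_fintype,
    Finset.sum_eq_single b]
  · simp [ENNReal.mul_inv]
  · intro b' _ hb
    simp [hb.symm]
  · simp
  · intro a' _ ha
    rw [PMF.map_apply]
    simp [ha.symm]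
  · simp

theorem uniform_map_fst {α β : Type} [Fintype α] [Fintype β] [Nonempty α] [Nonempty β] :
    (PMF.uniformOfFintype (α × β)).map Prod.fst = PMF.uniformOfFintype α := by
  rw [uniform_prod, PMF.map_bind]
  simp_rw [PMF.map_comp]
  have : ∀ a : α, (PMF.uniformOfFintype β).map (Prod.fst ∘ fun b => (a, b)) = PMF.pure a :=
    fun a => PMF.map_const _ _
  simp_rw [this]
  exact PMF.bind_pure _

theorem uniform_map_equiv {α β : Type} [Fintype α] [Fintype β] [Nonempty α] [Nonempty β]
    (e : α ≃ β) : (PMF.uniformOfFintype α).map e = PMF.uniformOfFintype β := by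
  classical
  ext b
  rw [PMF.map_apply, tsum_fintype, Finset.sum_eq_single (e.symm b)]
  · simp [Fintype.card_congr e]
  · intro a _ ha
    rw [if_neg]
    rintro rfl
    simp at ha
  · simp

theorem uniform_map_eval {ι α : Type} [Fintype ι] [DecidableEq ι] [Fintype α] [Nonempty α]
    (i : ι) : (PMF.uniformOfFintype (ι → α)).map (fun f => f i) = PMF.uniformOfFintype α := by
  have h : (fun f : ι → α => f i) = Prod.fst ∘ Equiv.funSplitAt i α := rfl
  rw [h, ← PMF.map_comp, uniform_map_equiv, uniform_map_fst]

theorem uniform_map_apply_eq {α β : Type} [Fintype α] [Nonempty α] (G : α → β) (e : α ≃ α)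
    (y y' : β) (h : ∀ x, G x = y ↔ G (e x) = y') :
    ((PMF.uniformOfFintype α).map G) y = ((PMF.uniformOfFintype α).map G) y' := by
  classical
  rw [PMF.map_apply, PMF.map_apply]
  refine Eq.trans ?_ (e.tsum_eq _)
  refine tsum_congr fun x => ?_
  rw [PMF.uniformOfFintype_apply, PMF.uniformOfFintype_apply]
  exact if_congr (by rw [eq_comm, h x, eq_comm]) rfl rfl

/-- If the joint mass does not depend on the first coordinate, then X is uniform and independent of
Y; the entropies then add up by `Real.negMulLog_mul`. -/
theorem mutualInfo_eq_zero {Ω α β : Type} [Fintype α] [Fintype β] (p : PMF Ω) (X : Ω → α)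
    (Y : Ω → β) (h : ∀ a a' y, (p.map fun ω => (X ω, Y ω)) (a, y) =
      (p.map fun ω => (X ω, Y ω)) (a', y)) : mutualInfo p X Y = 0 := by
  classical
  obtain ⟨a₀⟩ : Nonempty α := (p.map X).support_nonempty.to_type
  set q := p.map fun ω => (X ω, Y ω) with hq
  set u : β → ℝ := fun y => (q (a₀, y)).toReal with hu
  have hqu : ∀ x, (q x).toReal = u x.2 := fun x => congrArg _ (h x.1 a₀ x.2)
  have hX : p.map X = q.map Prod.fst := by rw [hq, PMF.map_comp]; rfl
  have hY : p.map Y = q.map Prod.snd := by rw [hq, PMF.map_comp]; rfl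
  have hX' : ∀ a, ((p.map X) a).toReal = ∑ y, u y := by
    intro a
    rw [hX, map_toReal, Fintype.sum_prod_type]
    simp [hqu]
  have hY' : ∀ y, ((p.map Y) y).toReal = Fintype.card α * u y := by
    intro y
    rw [hY, map_toReal, Fintype.sum_prod_type]
    simp [hqu]
  have hs : (Fintype.card α : ℝ) * ∑ y, u y = 1 := by
    rw [← sum_toReal (p.map X), Finset.sum_congr rfl fun a _ => hX' a]
    simp
  set v := ∑ y, u y
  set c : ℝ := (Fintype.card α : ℝ)
  have hneg : ∀ y, Real.negMulLog (u y) =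
      c * u y * Real.negMulLog v + v * Real.negMulLog (c * u y) := by
    intro y
    rw [← Real.negMulLog_mul, ← mul_assoc, mul_comm v c, hs, one_mul]
  unfold mutualInfo
  rw [entropy_eq, entropy_eq, entropy_eq, ← hq]
  unfold pmfEntropy
  simp_rw [hX', hY', hqu]
  rw [Fintype.sum_prod_type]
  simp only [Finset.sum_const, Finset.card_univ, nsmul_eq_mul]
  change c * Real.negMulLog v / Real.log 2 + (∑ y, Real.negMulLog (c * u y)) / Real.log 2 -
    c * (∑ y, Real.negMulLog (u y)) / Real.log 2 = 0
  simp_rw [hneg]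
  rw [Finset.sum_add_distrib, ← Finset.sum_mul, ← Finset.mul_sum, ← Finset.mul_sum]
  change c * Real.negMulLog v / Real.log 2 + _ - c * (c * v * _ + _) / Real.log 2 = 0
  rw [hs, one_mul, mul_add, ← mul_assoc, hs]
  ring

/-! ### From perfect schemes to private schemes -/

/-- Files of `F` bits can be represented in an alphabet with almost as many symbols, with a small
probability of failure. -/
theorem exists_file_encoding (F : ℕ) (𝓦 : Type) [Fintype 𝓦] [Nonempty 𝓦] (ε : ℝ) (hε : 0 ≤ ε)
    (h : (1 - ε) * 2 ^ F ≤ Fintype.card 𝓦) :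
    ∃ (e : Fin (2 ^ F) → 𝓦) (e' : 𝓦 → Fin (2 ^ F)),
      ((PMF.uniformOfFintype (Fin (2 ^ F))).toOuterMeasure {w | e' (e w) ≠ w}).toReal ≤ ε := by
  classical
  have hpos : 0 < 2 ^ F := by positivity
  set n := Fintype.card 𝓦 with hn
  let eq := Fintype.equivFin 𝓦
  refine ⟨fun w => if hw : (w : ℕ) < n then eq.symm ⟨w, hw⟩ else Classical.arbitrary 𝓦,
    fun x => if hx : (eq x : ℕ) < 2 ^ F then ⟨eq x, hx⟩ else ⟨0, hpos⟩, ?_⟩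
  have hsub : {w : Fin (2 ^ F) | (fun x => if hx : (eq x : ℕ) < 2 ^ F then
      (⟨eq x, hx⟩ : Fin (2 ^ F)) else ⟨0, hpos⟩) (if hw : (w : ℕ) < n then eq.symm ⟨w, hw⟩ else
        Classical.arbitrary 𝓦) ≠ w} ⊆ {w | ¬ (w : ℕ) < n} := by
    intro w hw hlt
    refine hw ?_
    simp [hlt]
  have hcard : (Fintype.card {w : Fin (2 ^ F) | ¬ (w : ℕ) < n} : ℝ) ≤ ε * 2 ^ F := by
    have h1 : Fintype.card {w : Fin (2 ^ F) | ¬ (w : ℕ) < n} = 2 ^ F - min (2 ^ F) n := by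
      have h2 := Fintype.card_subtype_compl (fun w : Fin (2 ^ F) => (w : ℕ) < n)
      rw [Fintype.card_fin, Fintype.card_subtype (fun w : Fin (2 ^ F) => (w : ℕ) < n),
        Fin.card_filter_val_lt] at h2
      exact h2
    rw [h1]
    rcases le_total (2 ^ F) n with h3 | h3
    · rw [min_eq_left h3]
      simp only [Nat.sub_self, Nat.cast_zero]
      positivity
    · rw [min_eq_right h3, Nat.cast_sub h3]
      push_cast
      linarith
  refine (toReal_toOuterMeasure_mono _ hsub).trans ?_
  rw [PMF.toOuterMeasure_uniformOfFintype_apply, ENNReal.toReal_div, Fintype.card_fin]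
  simp only [ENNReal.toReal_natCast, Nat.cast_pow, Nat.cast_ofNat, ENNReal.toReal_pow,
    ENNReal.toReal_ofNat]
  rw [div_le_iff₀ (by positivity)]
  exact hcard

namespace PerfectScheme

variable {N K F : ℕ} {M R : ℝ} {𝓦 Ω 𝓧 : Type} {𝓩 : Fin K → Type}

theorem exists_scheme [Fintype 𝓦] [Fintype Ω] [Nonempty 𝓦] [Nonempty Ω]
    (P : PerfectScheme N K 𝓦 Ω 𝓧 𝓩) (hN : 0 < N) (hK : 0 < K)
    (iX : 𝓧 ↪ Alphabet R F) (iZ : ∀ k, 𝓩 k ↪ Alphabet M F) (ε : ℝ) (hε : 0 ≤ ε)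
    (hcard : (1 - ε) * 2 ^ F ≤ Fintype.card 𝓦) :
    ∃ S : Scheme N K F M R, S.IsPrivate (K * ε) 0 := by
  classical
  have : Nonempty (Fin N) := ⟨⟨0, hN⟩⟩
  have : Nonempty (Fin K) := ⟨⟨0, hK⟩⟩
  obtain ⟨e, e', he⟩ := exists_file_encoding F 𝓦 ε hε hcard
  set C : Files N F → Ω → Fin K → Alphabet M F :=
    fun W ω k => iZ k (P.cache (fun n => e (W n)) ω k) with hC
  have x₀ : Alphabet R F := iX (P.tx (fun _ => ⟨0, hN⟩) (fun _ => Classical.arbitrary 𝓦)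
    (Classical.arbitrary Ω))
  let S : Scheme N K F M R :=
    { placement := fun W => (PMF.uniformOfFintype Ω).map (C W)
      -- The server sees only files and caches, so it picks some randomness consistent with them;
      -- `tx_eq` makes the choice immaterial. The decoder likewise relies on `decodable`.
      transmit := fun d W Z => if h : ∃ ω, C W ω = Z then
        iX (P.tx d (fun n => e (W n)) h.choose) else x₀
      decode := fun d k x z => if h : ∃ (W : Fin N → 𝓦) (ω : Ω), iX (P.tx d W ω) = x ∧
        iZ k (P.cache W ω k) = z then e' (h.choose (d k)) else ⟨0, by positivity⟩ }
  have htx : ∀ d W ω, S.transmit d W (C W ω) = iX (P.tx d (fun n => e (W n)) ω) := by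
    intro d W ω
    have h : ∃ ω', C W ω' = C W ω := ⟨ω, rfl⟩
    change (if h : ∃ ω', C W ω' = C W ω then
        iX (P.tx d (fun n => e (W n)) h.choose) else x₀) = _
    rw [dif_pos h]
    refine congrArg iX (P.tx_eq _ _ _ _ ?_)
    funext k
    exact (iZ k).injective (congrFun h.choose_spec k)
  have hdec : ∀ d k W ω, S.decode d k (iX (P.tx d W ω)) (iZ k (P.cache W ω k)) =
      e' (W (d k)) := by
    intro d k W ω
    have h : ∃ (W' : Fin N → 𝓦) (ω' : Ω), iX (P.tx d W' ω') = iX (P.tx d W ω) ∧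
        iZ k (P.cache W' ω' k) = iZ k (P.cache W ω k) := ⟨W, ω, rfl, rfl⟩
    change (if h : ∃ (W' : Fin N → 𝓦) (ω' : Ω), iX (P.tx d W' ω') = iX (P.tx d W ω) ∧
        iZ k (P.cache W' ω' k) = iZ k (P.cache W ω k) then e' (h.choose (d k)) else _) = _
    rw [dif_pos h]
    obtain ⟨ω', h1, h2⟩ := h.choose_spec
    exact congrArg e' (P.decodable d k _ _ _ _ (iX.injective h1) ((iZ k).injective h2))
  have hlaw : S.law = (PMF.uniformOfFintype (Files N F × Ω)).map fun x => (x.1, C x.1 x.2) := by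
    rw [uniform_prod, PMF.map_bind]
    simp only [PMF.map_comp]
    change (PMF.uniformOfFintype (Files N F)).bind
      (fun W => ((PMF.uniformOfFintype Ω).map (C W)).map fun Z => (W, Z)) = _
    simp only [PMF.map_comp]
    rfl
  refine ⟨S, ciSup_le fun d => ?_, ciSup_le fun d => ciSup_le fun k => le_of_eq ?_⟩
  · rw [hlaw, PMF.toOuterMeasure_map_apply]
    have h1 := toReal_biUnion_le (PMF.uniformOfFintype (Files N F × Ω))
      (fun k : Fin K => {x | e' (e (x.1 (d k))) ≠ x.1 (d k)}) ε (fun k => by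
        have h2 : (PMF.uniformOfFintype (Files N F × Ω)).map (fun x => x.1 (d k)) =
            PMF.uniformOfFintype (Fin (2 ^ F)) := by
          rw [← uniform_map_eval (α := Fin (2 ^ F)) (d k), ← uniform_map_fst (α := Files N F) (β := Ω), PMF.map_comp]
          rfl
        rw [← h2, PMF.toOuterMeasure_map_apply] at he
        exact he)
    rw [Fintype.card_fin] at h1
    refine le_trans (toReal_toOuterMeasure_mono _ ?_) h1
    · intro x hx
      by_contra hnot
      simp only [Set.mem_iUnion, not_exists] at hnot
      refine hx (funext fun k => ?_)
      change S.decode d k (S.transmit d x.1 (C x.1 x.2)) (C x.1 x.2 k) = _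
      rw [htx, hdec]
      exact not_not.mp (hnot k)
  · refine mutualInfo_eq_zero _ _ _ fun a a' y => ?_
    rw [hlaw, PMF.map_comp]
    choose! σ hσ using P.secret d k
    -- Exchanges the values a and a' of the unrequested files and fixes the requested one. Sheared
    -- with the permutations of the randomness from `secret`, it preserves the view of user k.
    set τ : Files N F ≃ Files N F := ((Equiv.funSplitAt (d k) (Fin (2 ^ F))).trans
      (Equiv.prodCongr (Equiv.refl _) (Equiv.swap a a'))).trans
        (Equiv.funSplitAt (d k) (Fin (2 ^ F))).symm with hτ
    have hτ0 : ∀ W, τ W (d k) = W (d k) := fun W => by simp [hτ]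
    have hτ1 : ∀ W, (fun i : {i : Fin N // i ≠ d k} => τ W i) =
        Equiv.swap a a' (fun i : {i : Fin N // i ≠ d k} => W i) := fun W => by
      funext i
      have h := i.2
      simp [hτ, h]
    refine uniform_map_apply_eq _ (Equiv.prodShear τ fun W =>
      σ (fun n => e (W n)) (fun n => e (τ W n))) _ _ fun x => ?_
    have h1 := hσ (fun n => e (x.1 n)) (fun n => e (τ x.1 n)) (by simp only [hτ0]) x.2
    simp only [Function.comp, Equiv.prodShear_apply, Prod.mk.injEq, htx]
    simp only [hC]
    rw [h1.1, h1.2, hτ1]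
    constructor
    · rintro ⟨h2, h3⟩
      exact ⟨by rw [h2, Equiv.swap_apply_left], h3⟩
    · rintro ⟨h2, h3⟩
      refine ⟨?_, h3⟩
      rwa [← Equiv.eq_symm_apply, Equiv.symm_swap, Equiv.swap_apply_right] at h2

end PerfectScheme

/-! ### Secret sharing and coded delivery -/

/-- A linear secret sharing scheme with shares indexed by `ι`, in which user `k` holds the shares
`T` with `holds k T`: the shares that a user holds say nothing about the secret, and together with
the secret they determine the other shares. -/
structure SecretSharing (K : ℕ) (ι R 𝓦 : Type) [AddCommGroup R] [AddCommGroup 𝓦] where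
  /-- The secret that a family of shares represents. -/
  secret : (ι → R) →+ 𝓦
  /-- User `k` holds the share `T`. -/
  holds : Fin K → ι → Prop
  surj : ∀ k w, ∃ v, secret v = w ∧ ∀ T, holds k T → v T = 0
  inj : ∀ k v, secret v = 0 → (∀ T, holds k T → v T = 0) → v = 0

namespace SecretSharing

variable {K : ℕ} {ι R 𝓦 : Type} [AddCommGroup R] [AddCommGroup 𝓦] (Q : SecretSharing K ι R 𝓦)

/-- Some shares of the secret `w`. -/
def lift [NeZero K] (w : 𝓦) : ι → R := (Q.surj 0 w).choose

theorem secret_lift [NeZero K] (w : 𝓦) : Q.secret (Q.lift w) = w := (Q.surj 0 w).choose_spec.1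

/-- The shares of the secret `w` with randomness `r`. -/
def share [NeZero K] (w : 𝓦) (r : Q.secret.ker) : ι → R := r + Q.lift w

theorem secret_share [NeZero K] (w : 𝓦) (r : Q.secret.ker) : Q.secret (Q.share w r) = w := by
  have h : Q.secret (r : ι → R) = 0 := r.2
  rw [share, map_add, h, secret_lift, zero_add]

theorem eq_of_holds {k : Fin K} {s s' : ι → R} (h : Q.secret s = Q.secret s')
    (hs : ∀ T, Q.holds k T → s T = s' T) : s = s' := by
  rw [← sub_eq_zero]
  refine Q.inj k _ (by rw [map_sub, h, sub_self]) fun T hT => ?_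
  rw [Pi.sub_apply, hs T hT, sub_self]

/-- Changing the secret amounts to adding a vector v that vanishes on the shares of user k; the
difference of the chosen lifts is absorbed by translating the randomness within the kernel. -/
theorem exists_shift [NeZero K] (k : Fin K) (w w' : 𝓦) : ∃ (σ : Q.secret.ker ≃ Q.secret.ker)
    (v : ι → R), (∀ r, Q.share w' (σ r) = Q.share w r + v) ∧ (∀ T, Q.holds k T → v T = 0) ∧
      (w = w' → v = 0) := by
  obtain ⟨v, hv, hk⟩ := Q.surj k (w' - w)
  have hu : Q.lift w - Q.lift w' + v ∈ Q.secret.ker := by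
    rw [AddMonoidHom.mem_ker, map_add, map_sub, secret_lift, secret_lift, hv]
    abel
  refine ⟨Equiv.addRight ⟨_, hu⟩, v, fun r => ?_, hk, fun h => Q.inj k v ?_ hk⟩
  · simp only [share, Equiv.coe_addRight, AddSubgroup.coe_add]
    abel
  · rw [hv, h, sub_self]

end SecretSharing

/-- A pattern of coded transmissions for a secret sharing scheme: the block `b` sends to every user
in `users b` a share that all the other users of the block hold. The keyed blocks are masked by a
key known to the users of the block. -/
structure Delivery {K : ℕ} {ι R 𝓦 : Type} [AddCommGroup R] [AddCommGroup 𝓦]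
    (Q : SecretSharing K ι R 𝓦) (β : Type) where
  /-- The users that the block is intended for. -/
  users : β → Finset (Fin K)
  /-- The share that the block delivers to a user. -/
  index : ∀ b, {j // j ∈ users b} → ι
  /-- The block is masked by a key. -/
  keyed : β → Prop
  holds_index : ∀ b (j : {j // j ∈ users b}), ∀ k ∈ users b, (j : Fin K) ≠ k → Q.holds k (index b j)
  exists_block : ∀ k T, ¬ Q.holds k T → ∃ (b : β) (h : k ∈ users b), index b ⟨k, h⟩ = T
  keyed_of_notMem : ∀ b k, k ∉ users b → keyed b
  users_nonempty : ∀ b, (users b).Nonempty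

namespace Delivery

variable {K : ℕ} {ι R 𝓦 β : Type} [AddCommGroup R] [AddCommGroup 𝓦]
  {Q : SecretSharing K ι R 𝓦} (D : Delivery Q β)

/-- What user `k` stores of `N` files. -/
abbrev Cache (N : ℕ) (k : Fin K) : Type :=
  (Fin N → {T // Q.holds k T} → R) × ({b // D.keyed b ∧ k ∈ D.users b} → R)

open Classical in
/-- The perfect scheme given by secret sharing and coded delivery. -/
def perfectScheme [NeZero K] (N : ℕ) : PerfectScheme N K 𝓦 ((Fin N → Q.secret.ker) × (β → R))
    (β → R) (D.Cache N) where
  cache W ω k := (fun n T => Q.share (W n) (ω.1 n) T, fun b => ω.2 b)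
  tx d W ω b := (if D.keyed b then ω.2 b else 0) +
    ∑ j ∈ (D.users b).attach, Q.share (W (d j)) (ω.1 (d j)) (D.index b j)
  tx_eq d W ω ω' h := by
    have hs : ∀ n, Q.share (W n) (ω.1 n) = Q.share (W n) (ω'.1 n) := fun n =>
      -- The shares in one cache together with the known secret fix all shares.
      Q.eq_of_holds (k := 0) (by rw [Q.secret_share, Q.secret_share]) fun T hT =>
        congrFun (congrFun (congrArg Prod.fst (congrFun h 0)) n) ⟨T, hT⟩
    funext b
    simp only [hs]
    congr 1
    split_ifs with hb
    · obtain ⟨k, hk⟩ := D.users_nonempty b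
      exact congrFun (congrArg Prod.snd (congrFun h k)) ⟨b, hb, hk⟩
    · rfl
  decodable d k W W' ω ω' htx hc := by
    have hheld : ∀ n T, Q.holds k T → Q.share (W n) (ω.1 n) T = Q.share (W' n) (ω'.1 n) T :=
      fun n T hT => congrFun (congrFun (congrArg Prod.fst hc) n) ⟨T, hT⟩
    have hs : Q.share (W (d k)) (ω.1 (d k)) = Q.share (W' (d k)) (ω'.1 (d k)) := by
      funext T
      by_cases hT : Q.holds k T
      · exact hheld _ T hT
      · obtain ⟨b, hk, rfl⟩ := D.exists_block k T hT
        have hb := congrFun htx b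
        have hkey : (if D.keyed b then ω.2 b else 0) = if D.keyed b then ω'.2 b else 0 := by
          split_ifs with hb
          · exact congrFun (congrArg Prod.snd hc) ⟨b, hb, hk⟩
          · rfl
        simp only [hkey, add_right_inj] at hb
        -- All summands but the one meant for user k are shares that k holds, so they cancel.
        have hrest : ∀ j ∈ (D.users b).attach.erase ⟨k, hk⟩,
            Q.share (W (d j)) (ω.1 (d j)) (D.index b j) =
              Q.share (W' (d j)) (ω'.1 (d j)) (D.index b j) := fun j hj =>
          hheld _ _ (D.holds_index b j k hk fun h => (Finset.mem_erase.mp hj).1 (Subtype.ext h))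
        rw [← Finset.add_sum_erase _ _ (Finset.mem_attach _ (⟨k, hk⟩ : {j // j ∈ D.users b})),
          ← Finset.add_sum_erase _ _ (Finset.mem_attach _ (⟨k, hk⟩ : {j // j ∈ D.users b})),
          Finset.sum_congr rfl hrest] at hb
        exact add_right_cancel hb
    rw [← Q.secret_share (W (d k)) (ω.1 (d k)), hs, Q.secret_share]
  secret d k W W' hW := by
    choose σ v hσ hv hv0 using fun n => Q.exists_shift k (W n) (W' n)
    -- In a block containing k the shift is invisible: k's own term belongs to the unchanged file
    -- and the others are held by k. In any other block the key, unknown to k, absorbs the shift.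
    refine ⟨Equiv.prodCongr (Equiv.piCongrRight σ) (Equiv.addRight fun b =>
      if k ∈ D.users b then 0 else
        -∑ j ∈ (D.users b).attach, v (d j) (D.index b j)), fun ω => ⟨?_, Prod.ext ?_ ?_⟩⟩
    · funext b
      simp only [Equiv.prodCongr_apply, Prod.map, Equiv.piCongrRight_apply, Pi.map_apply, hσ,
        Equiv.coe_addRight, Pi.add_apply, Finset.sum_add_distrib]
      by_cases hk : k ∈ D.users b
      · have h0 : ∑ j ∈ (D.users b).attach, v (d j) (D.index b j) = 0 := by
          refine Finset.sum_eq_zero fun j _ => ?_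
          by_cases hj : (j : Fin K) = k
          · rw [hj, hv0 _ hW]; rfl
          · exact hv _ _ (D.holds_index b j k hk hj)
        simp [hk, h0]
      · simp only [D.keyed_of_notMem b k hk, if_true, hk, if_false]
        abel
    · funext n T
      simp [hσ, hv n T T.2]
    · funext b
      simp [b.2.2]

end Delivery

/-! ### Concrete sharing schemes and their deliveries -/

/-- Additive secret sharing among `K` users, each of whom misses one share. -/
def additiveSharing (K : ℕ) (R : Type) [AddCommGroup R] : SecretSharing K (Fin K) R R where
  secret :=
    { toFun := fun v => ∑ i, v i
      map_zero' := by simp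
      map_add' := fun v w => Finset.sum_add_distrib }
  holds k j := j ≠ k
  surj k w := ⟨Pi.single k w, by simp, fun _ hT => by simp [hT]⟩
  inj k v hv hk := by
    have h1 : ∑ i, v i = v k := Finset.sum_eq_single k (fun j _ hj => hk j hj) (by simp)
    funext j
    by_cases hj : j = k
    · subst hj
      exact h1.symm.trans hv
    · exact hk j hj

/-- A single transmission that serves all users. -/
def additiveDelivery (K : ℕ) [NeZero K] (R : Type) [AddCommGroup R] :
    Delivery (additiveSharing K R) Unit where
  users _ := Finset.univ
  index _ j := j
  keyed _ := False
  holds_index _ _ _ _ h := h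
  exists_block k _ h := ⟨(), Finset.mem_univ k, (not_not.mp h).symm⟩
  keyed_of_notMem _ k h := absurd (Finset.mem_univ k) h
  users_nonempty _ := Finset.univ_nonempty

/-- The first `c` power sums over the points `x T`, with weights in `ZMod q`. If all positive
integers up to the largest point are coprime to `q`, this map is bijective on the vectors supported
on any set of `c` points. -/
def powerSums {ι : Type} [Fintype ι] (x : ι → ℕ) (q c : ℕ) : (ι → ZMod q) →+ (Fin c → ZMod q) where
  toFun v i := ∑ T, v T * (x T : ZMod q) ^ (i : ℕ)
  map_zero' := by
    funext i
    simp
  map_add' v w := by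
    funext i
    simp [add_mul, Finset.sum_add_distrib]

section

variable {ι : Type} [Fintype ι] {x : ι → ℕ} {q c m : ℕ}

theorem isUnit_sub (hq : ∀ a, 0 < a → a < m → a.Coprime q) {a b : ℕ} (ha : a < m) (hb : b < m)
    (hab : a ≠ b) : IsUnit ((a : ZMod q) - b) := by
  rcases lt_or_gt_of_ne hab with h | h
  · rw [← neg_sub, ← Nat.cast_sub h.le, IsUnit.neg_iff, ZMod.isUnit_iff_coprime]
    exact hq _ (by omega) (by omega)
  · rw [← Nat.cast_sub h.le, ZMod.isUnit_iff_coprime]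
    exact hq _ (by omega) (by omega)

theorem isUnit_vandermonde (hq : ∀ a, 0 < a → a < m → a.Coprime q) (y : Fin c → ℕ)
    (hy : Function.Injective y) (hm : ∀ i, y i < m) :
    IsUnit (Matrix.vandermonde fun i => (y i : ZMod q)).det := by
  rw [Matrix.det_vandermonde]
  refine (IsUnit.prod_univ_iff.mpr fun i => IsUnit.prod_iff.mpr fun j hj => ?_)
  refine isUnit_sub hq (hm j) (hm i) fun h => ?_
  exact (Finset.mem_Ioi.mp hj).ne' (hy h)

/-- Turns bijectivity on vectors supported on c points into invertibility of a square Vandermonde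
matrix. -/
theorem powerSums_extend (e : Fin c → ι) (he : Function.Injective e) (u : Fin c → ZMod q) :
    powerSums x q c (Function.extend e u 0) =
      Matrix.vecMul u (Matrix.vandermonde fun i => (x (e i) : ZMod q)) := by
  classical
  funext i
  change ∑ T, Function.extend e u 0 T * (x T : ZMod q) ^ (i : ℕ) =
    ∑ j, u j * (x (e j) : ZMod q) ^ (i : ℕ)
  rw [← Finset.sum_subset (Finset.subset_univ (Finset.univ.map ⟨e, he⟩)), Finset.sum_map]
  · simp [he.extend_apply]
  · intro T _ hT
    rw [Function.extend_apply', Pi.zero_apply, zero_mul]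
    rintro ⟨j, rfl⟩
    simp at hT

/-- Secret sharing with power sums. -/
def powerSumSharing {K : ℕ} (hq : ∀ a, 0 < a → a < m → a.Coprime q)
    (hx : Function.Injective x) (hm : ∀ T, x T < m) (holds : Fin K → ι → Prop)
    (e : ∀ k, Fin c ≃ {T // ¬ holds k T}) : SecretSharing K ι (ZMod q) (Fin c → ZMod q) where
  secret := powerSums x q c
  holds := holds
  surj k w := by
    set f : Fin c → ι := fun i => e k i
    have hf : Function.Injective f := Subtype.val_injective.comp (e k).injective
    have hu := isUnit_vandermonde hq (fun i => x (f i)) (hx.comp hf) fun i => hm _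
    refine ⟨Function.extend f (Matrix.vecMul w (Matrix.vandermonde fun i =>
      ((x (f i) : ℕ) : ZMod q))⁻¹) 0, ?_, fun T hT => ?_⟩
    · rw [powerSums_extend f hf, Matrix.vecMul_vecMul, Matrix.nonsing_inv_mul _ hu,
        Matrix.vecMul_one]
    · rw [Function.extend_apply', Pi.zero_apply]
      rintro ⟨j, rfl⟩
      exact (e k j).2 hT
  inj k v hv hk := by
    set f : Fin c → ι := fun i => e k i
    have hf : Function.Injective f := Subtype.val_injective.comp (e k).injective
    have hu := isUnit_vandermonde hq (fun i => x (f i)) (hx.comp hf) fun i => hm _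
    have hv' : v = Function.extend f (fun i => v (f i)) 0 := by
      funext T
      by_cases hT : holds k T
      · rw [hk T hT, Function.extend_apply', Pi.zero_apply]
        rintro ⟨j, rfl⟩
        exact (e k j).2 hT
      · have h1 : f ((e k).symm ⟨T, hT⟩) = T := by simp [f]
        rw [← h1, hf.extend_apply]
    rw [hv', powerSums_extend f hf] at hv
    have h0 : (fun i => v (f i)) = 0 := by
      rw [← Matrix.vecMul_one fun i => v (f i), ← Matrix.mul_nonsing_inv _ hu,
        ← Matrix.vecMul_vecMul, hv, Matrix.zero_vecMul]
    rw [hv', h0]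
    funext T
    by_cases hT : ∃ j, f j = T
    · obtain ⟨j, rfl⟩ := hT
      rw [hf.extend_apply]; rfl
    · rw [Function.extend_apply' _ _ _ hT]

/-- The coded delivery of shares indexed by the sets of `t` users. -/
def subsetDelivery {K t : ℕ} {R 𝓦 : Type} [AddCommGroup R] [AddCommGroup 𝓦]
    (Q : SecretSharing K {T : Finset (Fin K) // T.card = t} R 𝓦)
    (hQ : ∀ k T, Q.holds k T ↔ k ∈ T.1) :
    Delivery Q {B : Finset (Fin K) // B.card = t + 1} where
  users B := B.1
  index B j := ⟨B.1.erase j, by rw [Finset.card_erase_of_mem j.2, B.2]; rfl⟩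
  keyed _ := True
  holds_index B j k hk hj := (hQ _ _).mpr (Finset.mem_erase.mpr ⟨hj.symm, hk⟩)
  exists_block k T hT := by
    have hk : k ∉ T.1 := fun h => hT ((hQ _ _).mpr h)
    exact ⟨⟨insert k T.1, by rw [Finset.card_insert_of_notMem hk, T.2]⟩,
      Finset.mem_insert_self _ _, Subtype.ext (Finset.erase_insert hk)⟩
  keyed_of_notMem _ _ _ := trivial
  users_nonempty B := Finset.card_pos.mp (by rw [B.2]; omega)

end

/-! ### Asymptotic achievability by perfect schemes -/

/-- The memory-rate pair `(M, R)` is achieved by perfect schemes, up to a factor arbitrarily close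
to one in the size of the file alphabet. -/
def PerfectlyAchievable (N K : ℕ) (M R : ℝ) : Prop :=
  ∀ ρ < (1 : ℝ), ∃ x₀ : ℝ, ∀ x ≥ x₀, ∃ (𝓦 Ω 𝓧 : Type) (𝓩 : Fin K → Type),
    Finite 𝓦 ∧ Nonempty 𝓦 ∧ Finite Ω ∧ Nonempty Ω ∧ Finite 𝓧 ∧ (∀ k, Finite (𝓩 k)) ∧
    Nonempty (PerfectScheme N K 𝓦 Ω 𝓧 𝓩) ∧
    ρ * 2 ^ x ≤ Nat.card 𝓦 ∧ (Nat.card 𝓧 : ℝ) ≤ 2 ^ (R * x) ∧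
    ∀ k, (Nat.card (𝓩 k) : ℝ) ≤ 2 ^ (M * x)

theorem PerfectlyAchievable.privatelyAchievable {N K : ℕ} {M R : ℝ}
    (h : PerfectlyAchievable N K M R) (hN : 0 < N) (hK : 0 < K) :
    PrivatelyAchievable N K M R := by
  intro ε hε δ hδ
  have hK' : (0 : ℝ) < K := by exact_mod_cast hK
  obtain ⟨x₀, hx⟩ := h (1 - ε / K) (by linarith [div_pos hε hK'])
  obtain ⟨F₀, hF₀⟩ := exists_nat_ge x₀
  refine ⟨F₀, fun F hF => ?_⟩
  obtain ⟨𝓦, Ω, 𝓧, 𝓩, h1, h2, h3, h4, h5, h6, ⟨P⟩, hW, hX, hZ⟩ :=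
    hx F (hF₀.trans (by exact_mod_cast hF))
  have := Fintype.ofFinite 𝓦
  have := Fintype.ofFinite Ω
  have := Fintype.ofFinite 𝓧
  have := fun k => Fintype.ofFinite (𝓩 k)
  have eX : Nonempty (𝓧 ↪ Alphabet R F) := Function.Embedding.nonempty_of_card_le (by
    rw [Fintype.card_fin, ← Nat.card_eq_fintype_card]
    exact Nat.le_floor hX)
  have eZ : ∀ k, Nonempty (𝓩 k ↪ Alphabet M F) := fun k =>
    Function.Embedding.nonempty_of_card_le (by
      rw [Fintype.card_fin, ← Nat.card_eq_fintype_card]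
      exact Nat.le_floor (hZ k))
  obtain ⟨S, hS⟩ := P.exists_scheme hN hK eX.some (fun k => (eZ k).some) (ε / K) (by positivity)
    (by rwa [← Nat.card_eq_fintype_card, ← Real.rpow_natCast])
  exact ⟨S, hS.1.trans_eq (by field_simp), hS.2.trans hδ.le⟩

theorem PerfectlyAchievable.mono {N K : ℕ} {M M' R : ℝ} (h : PerfectlyAchievable N K M R)
    (hM : M ≤ M') : PerfectlyAchievable N K M' R := by
  intro ρ hρ
  obtain ⟨x₀, hx⟩ := h ρ hρ
  refine ⟨max x₀ 0, fun x hxx => ?_⟩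
  obtain ⟨𝓦, Ω, 𝓧, 𝓩, h1, h2, h3, h4, h5, h6, h7, h8, h9, h10⟩ :=
    hx x ((le_max_left _ _).trans hxx)
  refine ⟨𝓦, Ω, 𝓧, 𝓩, h1, h2, h3, h4, h5, h6, h7, h8, h9, fun k => (h10 k).trans ?_⟩
  exact Real.rpow_le_rpow_of_exponent_le one_le_two
    (mul_le_mul_of_nonneg_right hM ((le_max_right _ _).trans hxx))

/-- Two perfect schemes used side by side. -/
def PerfectScheme.prod {N K : ℕ} {𝓦 Ω 𝓧 𝓦' Ω' 𝓧' : Type} {𝓩 𝓩' : Fin K → Type}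
    (P : PerfectScheme N K 𝓦 Ω 𝓧 𝓩) (P' : PerfectScheme N K 𝓦' Ω' 𝓧' 𝓩') :
    PerfectScheme N K (𝓦 × 𝓦') (Ω × Ω') (𝓧 × 𝓧') (fun k => 𝓩 k × 𝓩' k) where
  cache W ω k := (P.cache (fun n => (W n).1) ω.1 k, P'.cache (fun n => (W n).2) ω.2 k)
  tx d W ω := (P.tx d (fun n => (W n).1) ω.1, P'.tx d (fun n => (W n).2) ω.2)
  tx_eq d W ω ω' h := Prod.ext
    (P.tx_eq d _ _ _ (funext fun k => congrArg Prod.fst (congrFun h k)))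
    (P'.tx_eq d _ _ _ (funext fun k => congrArg Prod.snd (congrFun h k)))
  decodable d k W W' ω ω' h h' := Prod.ext
    (P.decodable d k (fun n => (W n).1) (fun n => (W' n).1) _ _ (congrArg Prod.fst h)
      (congrArg Prod.fst h'))
    (P'.decodable d k (fun n => (W n).2) (fun n => (W' n).2) _ _ (congrArg Prod.snd h)
      (congrArg Prod.snd h'))
  secret d k W W' h := by
    obtain ⟨σ, hσ⟩ := P.secret d k (fun n => (W n).1) (fun n => (W' n).1) (congrArg Prod.fst h)
    obtain ⟨σ', hσ'⟩ := P'.secret d k (fun n => (W n).2) (fun n => (W' n).2) (congrArg Prod.snd h)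
    exact ⟨Equiv.prodCongr σ σ', fun ω => ⟨Prod.ext (hσ ω.1).1 (hσ' ω.2).1,
      Prod.ext (hσ ω.1).2 (hσ' ω.2).2⟩⟩

/-- Memory sharing. -/
theorem convex_perfectlyAchievable (N K : ℕ) :
    Convex ℝ {P : ℝ × ℝ | PerfectlyAchievable N K P.1 P.2} := by
  rw [convex_iff_forall_pos]
  rintro ⟨M, R⟩ h ⟨M', R'⟩ h' a b ha hb hab ρ hρ
  -- For s ≥ (1 + ρ)/2 one has s² ≥ 2s - 1 ≥ ρ, so the two losses multiply to an admissible one; the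
  -- maximum with 0 covers negative ρ.
  obtain ⟨x₀, hx⟩ := h (max 0 ((1 + ρ) / 2)) (max_lt one_pos (by linarith))
  obtain ⟨x₁, hx'⟩ := h' (max 0 ((1 + ρ) / 2)) (max_lt one_pos (by linarith))
  refine ⟨max (x₀ / a) (x₁ / b), fun x hxx => ?_⟩
  obtain ⟨𝓦, Ω, 𝓧, 𝓩, h1, h2, h3, h4, h5, h6, ⟨P⟩, h8, h9, h10⟩ :=
    hx (a * x) (by
      have := (le_max_left _ _).trans hxx
      rwa [div_le_iff₀' ha] at this)
  obtain ⟨𝓦', Ω', 𝓧', 𝓩', h1', h2', h3', h4', h5', h6', ⟨P'⟩, h8', h9', h10'⟩ :=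
    hx' (b * x) (by
      have := (le_max_right _ _).trans hxx
      rwa [div_le_iff₀' hb] at this)
  have hexp : ∀ u v : ℝ, (2 : ℝ) ^ ((a * u + b * v) * x) =
      2 ^ (u * (a * x)) * 2 ^ (v * (b * x)) := fun u v => by
    rw [← Real.rpow_add two_pos]
    ring_nf
  refine ⟨𝓦 × 𝓦', Ω × Ω', 𝓧 × 𝓧', fun k => 𝓩 k × 𝓩' k, inferInstance, inferInstance,
    inferInstance, inferInstance, inferInstance, fun k => inferInstance, ⟨P.prod P'⟩, ?_, ?_,
    fun k => ?_⟩
  · rw [Nat.card_prod, Nat.cast_mul]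
    set s := max 0 ((1 + ρ) / 2)
    have hs0 : 0 ≤ s := le_max_left _ _
    have hs1 : ρ ≤ s * s := by
      have h12 : (1 + ρ) / 2 ≤ s := le_max_right _ _
      nlinarith [sq_nonneg (s - 1)]
    have h11 : (2 : ℝ) ^ x = 2 ^ (a * x) * 2 ^ (b * x) := by
      rw [← Real.rpow_add two_pos, ← add_mul, hab, one_mul]
    calc ρ * 2 ^ x ≤ s * s * 2 ^ x := by gcongr
      _ = (s * 2 ^ (a * x)) * (s * 2 ^ (b * x)) := by rw [h11]; ring
      _ ≤ _ := by gcongr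
  · rw [Nat.card_prod, Nat.cast_mul]
    refine (mul_le_mul h9 h9' (by positivity) (by positivity)).trans_eq ?_
    simp only [Prod.smul_mk, Prod.mk_add_mk, smul_eq_mul, hexp]
  · rw [Nat.card_prod, Nat.cast_mul]
    refine (mul_le_mul (h10 k) (h10' k) (by positivity) (by positivity)).trans_eq ?_
    simp only [Prod.smul_mk, Prod.mk_add_mk, smul_eq_mul, hexp]

/-- Moduli without small prime factors whose `c`-th powers are close to a given size. -/
theorem exists_modulus (c m : ℕ) (hc : 0 < c) (ρ : ℝ) (hρ : ρ < 1) :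
    ∃ x₀ : ℝ, ∀ x ≥ x₀, ∃ q : ℕ, 0 < q ∧ (∀ a, 0 < a → a < m → a.Coprime q) ∧
      (q : ℝ) ≤ 2 ^ (x / c) ∧ ρ * 2 ^ x ≤ (q : ℝ) ^ c := by
  have hc' : (0 : ℝ) < c := by exact_mod_cast hc
  set f : ℕ := m.factorial with hf
  have hf0 : 0 < f := Nat.factorial_pos m
  have hf' : (0 : ℝ) < f := by exact_mod_cast hf0
  set B : ℝ := max (max 1 f) (c * f / (1 - ρ)) with hB
  have hB1 : 1 ≤ B := (le_max_left _ _).trans (le_max_left _ _)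
  refine ⟨c * Real.logb 2 B, fun x hx => ?_⟩
  set y : ℝ := 2 ^ (x / c) with hy
  have hyB : B ≤ y := by
    rw [hy, ← Real.logb_le_iff_le_rpow one_lt_two (by linarith), le_div_iff₀' hc']
    exact hx
  have hy1 : 1 ≤ y := hB1.trans hyB
  have hyf : (f : ℝ) ≤ y := (le_max_right _ _).trans ((le_max_left _ _).trans hyB)
  have hyρ : c * f ≤ y * (1 - ρ) := by
    rw [← div_le_iff₀ (by linarith)]
    exact (le_max_right _ _).trans hyB
  have hyc : y ^ c = 2 ^ x := by
    rw [hy, ← Real.rpow_natCast, ← Real.rpow_mul two_pos.le]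
    congr 1
    field_simp
  set z : ℕ := ⌊(y - 1) / f⌋₊ with hz
  have hz1 : (f : ℝ) * z ≤ y - 1 := by
    have := Nat.floor_le (a := (y - 1) / f) (div_nonneg (by linarith) hf'.le)
    rwa [le_div_iff₀' hf'] at this
  have hz2 : y - 1 < f * (z + 1) := by
    have := Nat.lt_floor_add_one ((y - 1) / f)
    rwa [div_lt_iff₀' hf'] at this
  -- A modulus congruent to 1 mod m! is coprime to every positive a < m, and such moduli have
  -- bounded gaps, so primes are not needed.
  refine ⟨f * z + 1, by omega, fun a ha ham => ?_, ?_, ?_⟩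
  · have hdvd : a ∣ f * z := (Nat.dvd_factorial ha ham.le).mul_right z
    obtain ⟨w, hw⟩ := hdvd
    rw [hw]
    simp
  · push_cast
    linarith
  · have hq : y - f ≤ ((f * z + 1 : ℕ) : ℝ) := by
      push_cast
      linarith
    have hy0 : y ≠ 0 := by linarith
    have hle : (f : ℝ) / y ≤ 1 := (div_le_one (by linarith)).mpr hyf
    -- Bernoulli: rounding y down by at most m! costs its c-th power a relative loss of at most c ·
    -- m!/y.
    have hber := one_add_mul_le_pow (a := -((f : ℝ) / y)) (by linarith) c
    have h1 : ρ ≤ 1 + (c : ℝ) * -((f : ℝ) / y) := by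
      have : (c : ℝ) * (f / y) ≤ 1 - ρ := by
        rw [← mul_div_assoc, div_le_iff₀' (by linarith)]
        exact hyρ
      linarith
    calc ρ * 2 ^ x ≤ (1 + -((f : ℝ) / y)) ^ c * y ^ c := by
          rw [hyc]
          gcongr
          exact h1.trans hber
      _ = (y - f) ^ c := by
          rw [← mul_pow]
          congr 1
          field_simp
          ring
      _ ≤ _ := by gcongr

theorem card_pow_le {q c : ℕ} (hc : 0 < c) {x r : ℝ} (hq : (q : ℝ) ≤ 2 ^ (x / c)) (n : ℕ)
    (hn : (n : ℝ) = r * c) : (q : ℝ) ^ n ≤ 2 ^ (r * x) := by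
  have hc' : (c : ℝ) ≠ 0 := by exact_mod_cast hc.ne'
  calc (q : ℝ) ^ n ≤ (2 ^ (x / c)) ^ n := by gcongr
    _ = 2 ^ (r * x) := by
      rw [← Real.rpow_natCast, ← Real.rpow_mul two_pos.le, hn]
      congr 1
      field_simp

/-! ### The corner points -/

theorem perfectlyAchievable_last (N K : ℕ) (hK : 0 < K) :
    PerfectlyAchievable N K ((N : ℝ) * ((K : ℝ) - 1)) 1 := by
  intro ρ hρ
  -- Additive sharing never divides, so no coprimality is asked of the modulus.
  obtain ⟨x₀, hx⟩ := exists_modulus 1 0 one_pos ρ hρ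
  refine ⟨x₀, fun x hxx => ?_⟩
  obtain ⟨q, hq0, -, hq1, hq2⟩ := hx x hxx
  have : NeZero K := ⟨hK.ne'⟩
  have : NeZero q := ⟨hq0.ne'⟩
  have hcard : ∀ (n : ℕ) {r : ℝ}, (n : ℝ) = r * (1 : ℕ) → (q : ℝ) ^ n ≤ 2 ^ (r * x) :=
    fun n _ h => card_pow_le one_pos hq1 n h
  refine ⟨ZMod q, _, _, _, inferInstance, inferInstance, ?_, ?_, ?_, fun k => ?_,
    ⟨(additiveDelivery K (ZMod q)).perfectScheme N⟩, ?_, ?_, fun k => ?_⟩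
  · infer_instance
  · infer_instance
  · infer_instance
  · infer_instance
  · simpa using hq2
  · simpa using hcard 1 (r := 1) (by simp)
  · have h1 : Nat.card {T // (additiveSharing K (ZMod q)).holds k T} = K - 1 := by
      have h2 := Fintype.card_subtype_compl (fun T : Fin K => T = k)
      rw [Fintype.card_subtype_eq, Fintype.card_fin] at h2
      rw [← h2, ← Nat.card_eq_fintype_card]
      rfl
    have h3 : IsEmpty {b // (additiveDelivery K (ZMod q)).keyed b ∧
        k ∈ (additiveDelivery K (ZMod q)).users b} := ⟨fun b => b.2.1⟩
    rw [Nat.card_prod, Nat.card_fun, Nat.card_fun, Nat.card_fun, h1, Nat.card_zmod, Nat.card_fin,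
      Nat.card_of_isEmpty, pow_zero, mul_one, ← pow_mul, Nat.cast_pow]
    refine hcard _ ?_
    rw [Nat.cast_mul, Nat.cast_sub hK]
    push_cast
    ring

theorem card_subsets (K t : ℕ) : Nat.card {T : Finset (Fin K) // T.card = t} = K.choose t := by
  rw [Nat.card_eq_fintype_card, Fintype.card_finset_len, Fintype.card_fin]

theorem card_subsets_notMem (K t : ℕ) (k : Fin K) :
    Nat.card {T : {T : Finset (Fin K) // T.card = t} // k ∉ T.1} = (K - 1).choose t := by
  rw [Nat.card_congr (Equiv.subtypeSubtypeEquivSubtypeInter (fun T : Finset (Fin K) => T.card = t)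
    fun T => k ∉ T), Nat.card_eq_fintype_card,
    Fintype.card_of_subtype (Finset.powersetCard t (Finset.univ.erase k)), Finset.card_powersetCard,
    Finset.card_erase_of_mem (Finset.mem_univ k), Finset.card_univ, Fintype.card_fin]
  intro T
  rw [Finset.mem_powersetCard, Finset.subset_erase]
  simp [and_comm]

theorem card_subsets_mem (K t : ℕ) (k : Fin K) :
    Nat.card {T : {T : Finset (Fin K) // T.card = t} // k ∈ T.1} + (K - 1).choose t =
      K.choose t := by
  classical
  rw [← card_subsets_notMem K t k, ← card_subsets, ← Nat.card_sum]
  exact Nat.card_congr (Equiv.sumCompl _)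

theorem cornerRate_cornerMemory (N K t : ℕ) (hN : 0 < N) (ht : t < K) :
    cornerRate N K (cornerMemory N K t) = K / (t + 1) := by
  have h1 : (0 : ℝ) < (K : ℝ) - t := sub_pos.mpr (by exact_mod_cast ht)
  have h2 : (0 : ℝ) < N := by exact_mod_cast hN
  have h3 : (0 : ℝ) < K := by exact_mod_cast (by omega : 0 < K)
  have h4 : (N : ℝ) + (cornerMemory N K t - 1) = N * K / (K - t) := by
    rw [cornerMemory]; field_simp; ring
  have h5 : (N : ℝ) + (K + 1) * (cornerMemory N K t - 1) = N * K * (t + 1) / (K - t) := by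
    rw [cornerMemory]; field_simp; ring
  rw [cornerRate, h5, add_sub_assoc, h4]
  field_simp

theorem perfectlyAchievable_corner (N K t : ℕ) (hN : 0 < N) (ht : t + 2 ≤ K) :
    PerfectlyAchievable N K (cornerMemory N K t) (cornerRate N K (cornerMemory N K t)) := by
  classical
  rw [cornerRate_cornerMemory N K t hN (by omega)]
  intro ρ hρ
  set c := (K - 1).choose t with hc
  have hc0 : 0 < c := Nat.choose_pos (by omega)
  have hc0' : (0 : ℝ) < c := by exact_mod_cast hc0
  obtain ⟨x₀, hx⟩ := exists_modulus c (K.choose t) hc0 ρ hρ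
  refine ⟨x₀, fun x hxx => ?_⟩
  obtain ⟨q, hq0, hqc, hq1, hq2⟩ := hx x hxx
  have : NeZero K := ⟨by omega⟩
  have : NeZero q := ⟨hq0.ne'⟩
  have hcard : ∀ (n : ℕ) {r : ℝ}, (n : ℝ) = r * c → (q : ℝ) ^ n ≤ 2 ^ (r * x) :=
    fun n _ h => card_pow_le hc0 hq1 n h
  let e : ∀ k : Fin K, Fin c ≃ {T : {T : Finset (Fin K) // T.card = t} // ¬ k ∈ T.1} := fun k =>
    (Finite.equivFinOfCardEq (card_subsets_notMem K t k)).symm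
  let x' : {T : Finset (Fin K) // T.card = t} ≃ Fin (K.choose t) :=
    Finite.equivFinOfCardEq (card_subsets K t)
  let Q : SecretSharing K {T : Finset (Fin K) // T.card = t} (ZMod q) (Fin c → ZMod q) :=
    powerSumSharing (x := fun T => (x' T : ℕ)) hqc (Fin.val_injective.comp x'.injective)
      (fun T => (x' T).2) (fun k T => k ∈ T.1) e
  have hKt : (0 : ℝ) < (K : ℝ) - t := sub_pos.mpr (by exact_mod_cast (by omega : t < K))
  refine ⟨Fin c → ZMod q, _, _, _, inferInstance, inferInstance, ?_, ?_, ?_, fun k => ?_,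
    ⟨(subsetDelivery Q fun k T => Iff.rfl).perfectScheme N⟩, ?_, ?_, fun k => ?_⟩
  · infer_instance
  · infer_instance
  · infer_instance
  · infer_instance
  · simpa using hq2
  · rw [Nat.card_fun, card_subsets, Nat.card_zmod, Nat.cast_pow]
    refine hcard _ ?_
    -- One symbol per (t + 1)-subset and c symbols per file give the rate C(K, t + 1)/c = K/(t + 1).
    have h1 := Nat.add_one_mul_choose_eq (K - 1) t
    rw [Nat.sub_add_cancel (by omega : 1 ≤ K)] at h1
    have h2 : (K : ℝ) * c = K.choose (t + 1) * (t + 1) := by exact_mod_cast h1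
    rw [div_mul_eq_mul_div, h2]
    field_simp
  · have h1 : Nat.card {T // Q.holds k T} + c = K.choose t := card_subsets_mem K t k
    -- Each user stores C(K - 1, t) = c keys, the size of one file: the summand 1 in the corner
    -- memory.
    have h2 : Nat.card {b // (subsetDelivery Q fun k T => Iff.rfl).keyed b ∧
        k ∈ (subsetDelivery Q fun k T => Iff.rfl).users b} = c := by
      have h3 := card_subsets_mem K (t + 1) k
      have h4 := Nat.choose_succ_succ (K - 1) t
      rw [Nat.succ_eq_add_one, Nat.sub_add_cancel (by omega : 1 ≤ K), Nat.succ_eq_add_one] at h4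
      have h5 : Nat.card {b // (subsetDelivery Q fun k T => Iff.rfl).keyed b ∧
          k ∈ (subsetDelivery Q fun k T => Iff.rfl).users b} =
          Nat.card {T : {T : Finset (Fin K) // T.card = t + 1} // k ∈ T.1} :=
        Nat.card_congr (Equiv.subtypeEquivRight fun b => (true_and _).to_iff)
      omega
    set A := Nat.card {T // Q.holds k T}
    rw [Nat.card_prod, Nat.card_fun, Nat.card_fun, Nat.card_fun, h2, Nat.card_zmod, Nat.card_fin,
      ← pow_mul, ← pow_add, Nat.cast_pow]
    refine hcard _ ?_
    -- The held shares of one file take up the fraction A/c = t/(K - t) of its size.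
    have h6 : (A : ℝ) * (K - t) = t * c := by
      have h7 := Nat.choose_mul_succ_eq (K - 1) t
      rw [Nat.sub_add_cancel (by omega : 1 ≤ K), ← hc, ← h1] at h7
      have h8 : (c : ℝ) * K = (A + c) * (K - t) := by
        rw [← Nat.cast_sub (by omega : t ≤ K)]
        exact_mod_cast h7
      linarith
    rw [cornerMemory]
    push_cast
    field_simp
    linear_combination (N : ℝ) * h6

theorem perfectlyAchievable_of_mem_convexHull (N K : ℕ) (hN : 0 < N) (hK : 0 < K) {P : ℝ × ℝ}
    (hP : P ∈ convexHull ℝ (cornerPoints N K)) : PerfectlyAchievable N K P.1 P.2 := by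
  refine convexHull_min ?_ (convex_perfectlyAchievable N K) hP
  rintro _ (⟨t, ht, rfl⟩ | rfl)
  · exact perfectlyAchievable_corner N K t hN ht
  · exact perfectlyAchievable_last N K hK

/-! ### The optimal rate and the centralized rate -/

theorem PrivatelyAchievable.one_le_rate {N K : ℕ} {M R : ℝ} (h : PrivatelyAchievable N K M R)
    (hN : 2 ≤ N) (hK : 1 ≤ K) : 1 ≤ R := by
  have := h.converse 0 1 (by omega) (by omega)
  norm_num at this
  linarith

theorem PrivatelyAchievable.one_le_memory {N K : ℕ} {M R : ℝ} (h : PrivatelyAchievable N K M R)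
    (hN : 2 ≤ N) (hK : 2 ≤ K) : 1 ≤ M := by
  have := h.converse 1 0 (by omega) (by omega)
  norm_num at this
  linarith

theorem optimalRate_le {N K : ℕ} {M R : ℝ} (h : PrivatelyAchievable N K M R)
    (hN : 2 ≤ N) (hK : 1 ≤ K) : optimalRate N K M ≤ R :=
  csInf_le ⟨1, fun _ hR => PrivatelyAchievable.one_le_rate hR hN hK⟩ h

/-- Supplies the lower bound without which the infimum defining the envelope could not be estimated
from above. -/
theorem one_le_of_mem_convexHull {N K : ℕ} (hN : 0 < N) {P : ℝ × ℝ}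
    (hP : P ∈ convexHull ℝ (cornerPoints N K)) : 1 ≤ P.2 := by
  have hconv : Convex ℝ {P : ℝ × ℝ | 1 ≤ P.2} :=
    convex_halfSpace_ge (f := Prod.snd) ⟨fun _ _ => rfl, fun _ _ => rfl⟩ 1
  refine convexHull_min ?_ hconv hP
  rintro _ (⟨t, ht, rfl⟩ | rfl)
  · change 1 ≤ cornerRate N K (cornerMemory N K t)
    rw [cornerRate_cornerMemory N K t hN (by omega), one_le_div (by positivity)]
    exact_mod_cast (by omega : t + 1 ≤ K)
  · exact le_refl (1 : ℝ)

theorem centralizedRate_le {N K : ℕ} (hN : 0 < N) {M r : ℝ} (hM : M ≤ (N : ℝ) * ((K : ℝ) - 1))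
    (hr : (M, r) ∈ convexHull ℝ (cornerPoints N K)) : centralizedRate N K M ≤ r := by
  rw [centralizedRate, if_pos hM]
  exact csInf_le ⟨1, fun _ h => one_le_of_mem_convexHull hN h⟩ hr

/-- The rate of the centralized scheme is at most that of any corner point to the left. -/
theorem exists_mem_convexHull {N K t : ℕ} (hN : 0 < N) (ht : t + 2 ≤ K) {M : ℝ}
    (h1 : cornerMemory N K t ≤ M) (h2 : M ≤ (N : ℝ) * ((K : ℝ) - 1)) :
    ∃ r ≤ (K : ℝ) / (t + 1), (M, r) ∈ convexHull ℝ (cornerPoints N K) := by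
  have hP : (cornerMemory N K t, (K : ℝ) / (t + 1)) ∈ cornerPoints N K :=
    Or.inl ⟨t, ht, by rw [cornerRate_cornerMemory N K t hN (by omega)]⟩
  have hL : ((N : ℝ) * ((K : ℝ) - 1), (1 : ℝ)) ∈ cornerPoints N K := Or.inr rfl
  have hK : (1 : ℝ) ≤ (K : ℝ) / (t + 1) := by
    rw [one_le_div (by positivity)]
    exact_mod_cast (by omega : t + 1 ≤ K)
  have hM : M ∈ segment ℝ (cornerMemory N K t) ((N : ℝ) * ((K : ℝ) - 1)) := by
    rw [segment_eq_Icc (h1.trans h2)]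
    exact ⟨h1, h2⟩
  obtain ⟨a, b, ha, hb, hab, hM⟩ := hM
  refine ⟨a * (K / (t + 1)) + b * 1, ?_, ?_⟩
  · nlinarith
  · have h3 := (convex_convexHull ℝ (cornerPoints N K)) (subset_convexHull ℝ _ hP)
      (subset_convexHull ℝ _ hL) ha hb hab
    simp only [smul_eq_mul] at hM
    simpa only [Prod.smul_mk, Prod.mk_add_mk, smul_eq_mul, hM] using h3

/-- Feasibility of the memory `M`. -/
def IsFeasibleMemory (K : ℕ) (M : ℝ) : Prop := 0 ≤ M ∧ (2 ≤ K → 1 ≤ M)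

theorem cornerMemory_zero (N K : ℕ) : cornerMemory N K 0 = 1 := by simp [cornerMemory]

theorem exists_mem_convexHull_of_feasible {N K : ℕ} (hN : 0 < N) (hK : 1 ≤ K) {M : ℝ}
    (hM : IsFeasibleMemory K M) (h2 : M ≤ (N : ℝ) * ((K : ℝ) - 1)) :
    ∃ r, (M, r) ∈ convexHull ℝ (cornerPoints N K) := by
  rcases hK.eq_or_lt with rfl | hK
  · have h0 : M = (N : ℝ) * (((1 : ℕ) : ℝ) - 1) := le_antisymm h2 (by simpa using hM.1)
    exact ⟨1, subset_convexHull ℝ _ (Or.inr (by rw [h0]; rfl))⟩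
  · obtain ⟨r, -, hr⟩ := exists_mem_convexHull hN hK
      ((cornerMemory_zero N K).trans_le (hM.2 hK)) h2
    exact ⟨r, hr⟩

theorem privatelyAchievable_one {N K : ℕ} (hN : 0 < N) (hK : 0 < K) {M : ℝ}
    (hM : (N : ℝ) * ((K : ℝ) - 1) ≤ M) : PrivatelyAchievable N K M 1 :=
  ((perfectlyAchievable_last N K hK).mono hM).privatelyAchievable hN hK

theorem exists_privatelyAchievable {N K : ℕ} (hN : 0 < N) (hK : 1 ≤ K) {M : ℝ}
    (hM : IsFeasibleMemory K M) : ∃ R, PrivatelyAchievable N K M R := by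
  rcases le_total M ((N : ℝ) * ((K : ℝ) - 1)) with h | h
  · obtain ⟨r, hr⟩ := exists_mem_convexHull_of_feasible hN hK hM h
    exact ⟨r, (perfectlyAchievable_of_mem_convexHull N K hN hK hr).privatelyAchievable hN hK⟩
  · exact ⟨1, privatelyAchievable_one hN hK h⟩

theorem one_le_optimalRate {N K : ℕ} (hN : 2 ≤ N) (hK : 1 ≤ K) {M : ℝ}
    (hM : IsFeasibleMemory K M) : 1 ≤ optimalRate N K M :=
  le_csInf (exists_privatelyAchievable (by omega) hK hM) fun _ hR => hR.one_le_rate hN hK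

theorem optimalRate_le_centralizedRate {N K : ℕ} (hN : 2 ≤ N) (hK : 1 ≤ K) {M : ℝ}
    (hM : IsFeasibleMemory K M) : optimalRate N K M ≤ centralizedRate N K M := by
  have hN0 : 0 < N := by omega
  unfold centralizedRate
  split_ifs with h
  · refine le_csInf (exists_mem_convexHull_of_feasible hN0 hK hM h) fun r hr => ?_
    exact optimalRate_le ((perfectlyAchievable_of_mem_convexHull N K hN0 hK hr).privatelyAchievable
      hN0 hK) hN hK
  · exact optimalRate_le (privatelyAchievable_one hN0 hK (not_le.mp h).le) hN hK

/-! ### The gap -/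

/-- The converse bound in the regime where the rate of the centralized scheme exceeds `16`. -/
theorem div_le_sixteen_mul {N K s : ℕ} (hs : 1 ≤ s) (hKs : 16 * s < K) {M R : ℝ}
    (hNs : K < N * (s + 1)) (hM : M < cornerMemory N K s) (h : PrivatelyAchievable N K M R) :
    (K : ℝ) / s ≤ 16 * R := by
  -- The converse is applied to x + 1 users, with x about K/(8s); the K - 1 makes 8sx < K strict.
  set x := (K - 1) / (8 * s) with hx
  have hx1 : 8 * s * x < K := by
    have := Nat.mul_div_le (K - 1) (8 * s)
    rw [← hx] at this
    omega
  have hx2 : K ≤ 8 * s * (x + 1) := by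
    have := Nat.lt_mul_div_succ (K - 1) (by omega : 0 < 8 * s)
    rw [← hx] at this
    omega
  have hx4 : 4 * x < N := by
    have h1 : 4 * x * (2 * s) < N * (2 * s) := by
      calc 4 * x * (2 * s) = 8 * s * x := by ring
        _ < K := hx1
        _ < N * (s + 1) := hNs
        _ ≤ N * (2 * s) := Nat.mul_le_mul_left _ (by omega)
    exact Nat.lt_of_mul_lt_mul_right h1
  have hN8 : 8 < N := by
    by_contra! h8
    have h1 := Nat.mul_le_mul_right (s + 1) h8
    omega
  have hxK : x + 1 ≤ K := by
    have : x ≤ 8 * s * x := Nat.le_mul_of_pos_left _ (by omega)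
    omega
  set p := N / (x + 1) with hp
  have hp1 : (x + 1) * p ≤ N := Nat.mul_div_le _ _
  have hp2 : N < (x + 1) * (p + 1) := Nat.lt_mul_div_succ _ (by omega)
  have hp3 : 2 ≤ p := by
    rw [hp, Nat.le_div_iff_mul_le (by omega)]
    omega
  obtain ⟨u, hu⟩ : ∃ u, p = u + 1 := ⟨p - 1, by omega⟩
  rw [hu] at hp1 hp2 hp3
  have hconv := h.converse x u hxK hp1
  have hu1 : (1 : ℝ) ≤ u := by exact_mod_cast (by omega : 1 ≤ u)
  have hs' : (1 : ℝ) ≤ s := by exact_mod_cast hs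
  have hKs' : 16 * (s : ℝ) ≤ K := by exact_mod_cast hKs.le
  have hx1' : 8 * (s : ℝ) * x ≤ K := by exact_mod_cast hx1.le
  have hx2' : (K : ℝ) ≤ 8 * s * (x + 1) := by exact_mod_cast hx2
  have hx4' : 4 * (x : ℝ) + 1 ≤ N := by exact_mod_cast hx4
  have hN8' : (8 : ℝ) ≤ N := by exact_mod_cast hN8.le
  have hp2' : (N : ℝ) + 1 ≤ (x + 1) * (u + 1 + 1) := by exact_mod_cast hp2
  have hx0 : (0 : ℝ) ≤ x := Nat.cast_nonneg x
  have hm : (M - 1) * (K - s) ≤ N * s := by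
    have h1 : M - 1 < N * s / (K - s) := by
      rw [cornerMemory] at hM
      linarith
    rw [lt_div_iff₀ (by linarith)] at h1
    exact h1.le
  -- The caches account for at most half of the bound: x(M - 1) is at most NK/(8(K - s)) with K - s
  -- ≥ 15K/16, while 4x < N gives (x + 1)u ≥ (N - 1)/2.
  have hkey : 2 * x * (M - 1) ≤ (x + 1) * u := by
    have h1 : (15 / 16 * K) * ((N - 1) / 2) ≤ ((K : ℝ) - s) * ((x + 1) * u) := by
      refine mul_le_mul (by linarith) ?_ (by linarith) (by linarith)
      linarith
    have h2 : (N : ℝ) * (8 * s * x) ≤ N * K := by gcongr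
    have h3 : 2 * (x : ℝ) * ((M - 1) * (K - s)) ≤ 2 * x * (N * s) := by gcongr
    have h4 : (K : ℝ) * 8 ≤ K * N := by gcongr
    refine le_of_mul_le_mul_right ?_ (by linarith : (0 : ℝ) < K - s)
    linarith
  -- The converse reads (x + 1)u ≤ uR + x(M - 1); by `hkey` at least half of the left side is left
  -- for uR.
  have hR : ((x : ℝ) + 1) ≤ 2 * R := by
    refine le_of_mul_le_mul_right ?_ (by linarith : (0 : ℝ) < u)
    linarith
  rw [div_le_iff₀ (by linarith)]
  have h5 : (s : ℝ) * (x + 1) ≤ s * (2 * R) := by gcongr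
  linarith

/-- For K > N, clearing denominators in M_0 < M_s leaves exactly K < N(s + 1). -/
theorem lt_mul_of_threshold_lt {N K s : ℕ} (hN : 2 ≤ N) (hs : 1 ≤ s) (hsK : s < K)
    (h : thresholdMemory N K < cornerMemory N K s) : K < N * (s + 1) := by
  rcases le_or_gt K N with hKN | hKN
  · calc K ≤ N := hKN
      _ < N * (s + 1) := by nlinarith
  · have hN' : (2 : ℝ) ≤ N := by exact_mod_cast hN
    have hK' : (0 : ℝ) < K := by exact_mod_cast (by omega : 0 < K)
    have hsK' : (0 : ℝ) < (K : ℝ) - s := sub_pos.mpr (by exact_mod_cast hsK)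
    have h1 : (N : ℝ) * (K - N) / ((N - 1) * K + N) < N * s / (K - s) := by
      have h2 := le_max_right 0 ((N : ℝ) * (K - N) / ((N - 1) * K + N))
      rw [thresholdMemory, cornerMemory] at h
      linarith
    have hpos : (0 : ℝ) < (N - 1) * K + N := by
      have : (0 : ℝ) ≤ (N - 1) * K := mul_nonneg (by linarith) hK'.le
      linarith
    rw [div_lt_div_iff₀ hpos hsK'] at h1
    have h3 : (K : ℝ) * (N * K) < N * (s + 1) * (N * K) := by nlinarith
    have h4 : (K : ℝ) < N * (s + 1) := lt_of_mul_lt_mul_right h3 (by positivity)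
    exact_mod_cast h4

/-- R ≥ 1 settles every case in which the centralized rate is at most 16; `div_le_sixteen_mul`
settles the rest. -/
theorem centralizedRate_le_sixteen_mul {N K : ℕ} (hN : 2 ≤ N) (hK : 1 ≤ K) {M R : ℝ}
    (hM : IsFeasibleMemory K M) (hM' : 2 ≤ K → thresholdMemory N K ≤ M)
    (h : PrivatelyAchievable N K M R) : centralizedRate N K M ≤ 16 * R := by
  have hN0 : 0 < N := by omega
  have hR := h.one_le_rate hN hK
  rcases lt_or_ge ((N : ℝ) * ((K : ℝ) - 1)) M with hL | hL
  · rw [centralizedRate, if_neg hL.not_ge]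
    linarith
  rcases hK.eq_or_lt with rfl | hK2
  · have h0 : M = (N : ℝ) * (((1 : ℕ) : ℝ) - 1) := le_antisymm hL (by simpa using hM.1)
    have h1 : (M, (1 : ℝ)) ∈ convexHull ℝ (cornerPoints N 1) :=
      subset_convexHull ℝ _ (Or.inr (by rw [h0]; rfl))
    have := centralizedRate_le hN0 hL h1
    linarith
  · classical
    set t := Nat.findGreatest (fun t => cornerMemory N K t ≤ M) (K - 2) with ht
    have ht1 : cornerMemory N K t ≤ M :=
      Nat.findGreatest_spec (P := fun t => cornerMemory N K t ≤ M) (Nat.zero_le _)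
        ((cornerMemory_zero N K).trans_le (hM.2 hK2))
    have ht2 : t ≤ K - 2 := Nat.findGreatest_le _
    obtain ⟨r, hr, hmem⟩ := exists_mem_convexHull hN0 (by omega : t + 2 ≤ K) ht1 hL
    refine ((centralizedRate_le hN0 hL hmem).trans hr).trans ?_
    rcases le_or_gt K (16 * (t + 1)) with hKt | hKt
    · have h1 : (K : ℝ) / (t + 1) ≤ 16 := by
        rw [div_le_iff₀ (by positivity)]
        exact_mod_cast hKt
      linarith
    -- Here 16(t + 1) < K, so t + 1 ≤ K - 2 is still a corner index and maximality of t applies to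
    -- it.
    · have h1 : M < cornerMemory N K (t + 1) :=
        not_le.mp (Nat.findGreatest_is_greatest (P := fun t => cornerMemory N K t ≤ M)
          (Nat.lt_succ_self t) (by omega))
      have h2 := lt_mul_of_threshold_lt hN (by omega : 1 ≤ t + 1) (by omega)
        ((hM' hK2).trans_lt h1)
      have h3 := div_le_sixteen_mul (by omega : 1 ≤ t + 1) hKt h2 h1 h
      exact_mod_cast h3

theorem rate_ratio_bounds {N K : ℕ} (hN : 2 ≤ N) (hK : 1 ≤ K) {M : ℝ}
    (hM : IsFeasibleMemory K M) (hM' : 2 ≤ K → thresholdMemory N K ≤ M) :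
    1 ≤ centralizedRate N K M / optimalRate N K M ∧
      centralizedRate N K M / optimalRate N K M ≤ 16 := by
  have h1 := one_le_optimalRate hN hK hM
  have hpos : 0 < optimalRate N K M := by linarith
  refine ⟨(one_le_div hpos).mpr (optimalRate_le_centralizedRate hN hK hM),
    (div_le_iff₀ hpos).mpr ?_⟩
  have h2 : centralizedRate N K M / 16 ≤ optimalRate N K M :=
    le_csInf (exists_privatelyAchievable (by omega) hK hM) fun R hR => by
      have := centralizedRate_le_sixteen_mul hN hK hM hM' hR
      linarith
  linarith

theorem thresholdMemory_of_le {N K : ℕ} (hN : 1 ≤ N) (h : K ≤ N) : thresholdMemory N K = 1 := by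
  have hN' : (1 : ℝ) ≤ N := by exact_mod_cast hN
  have hKN : (K : ℝ) ≤ N := by exact_mod_cast h
  have h1 : (N : ℝ) * (K - N) / ((N - 1) * K + N) ≤ 0 :=
    div_nonpos_of_nonpos_of_nonneg (mul_nonpos_of_nonneg_of_nonpos (by linarith) (by linarith))
      (add_nonneg (mul_nonneg (by linarith) (Nat.cast_nonneg K)) (by linarith))
  rw [thresholdMemory, max_eq_left h1, add_zero]

end PrivateCaching

end

theorem theorem3 (N K : ℕ) (hN : 2 ≤ N) (hK : 1 ≤ K) :
    (∀ M : ℝ, PrivateCaching.thresholdMemory N K ≤ M →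
      1 ≤ PrivateCaching.centralizedRate N K M / PrivateCaching.optimalRate N K M ∧
      PrivateCaching.centralizedRate N K M / PrivateCaching.optimalRate N K M ≤ 16) ∧
    (K ≤ N → ∀ M : ℝ, (∃ R : ℝ, PrivateCaching.PrivatelyAchievable N K M R) →
      1 ≤ PrivateCaching.centralizedRate N K M / PrivateCaching.optimalRate N K M ∧
      PrivateCaching.centralizedRate N K M / PrivateCaching.optimalRate N K M ≤ 16) := by
  refine ⟨fun M hM => ?_, fun hKN M ⟨R, hR⟩ => ?_⟩
  · have h1 : 1 ≤ M := (le_add_of_nonneg_right (le_max_left _ _)).trans hM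
    exact PrivateCaching.rate_ratio_bounds hN hK ⟨by linarith, fun _ => h1⟩ fun _ => hM
  · refine PrivateCaching.rate_ratio_bounds hN hK
      ⟨hR.nonneg_memory hK, fun hK2 => hR.one_le_memory hN hK2⟩ fun hK2 => ?_
    rw [PrivateCaching.thresholdMemory_of_le (by omega) hKN]
    exact hR.one_le_memory hN hK2
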